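/- **Notation.** $D=D[0,1]$ is the Banach space of functions $[0,1]\to\mathbb R$ that are right-continuous with left limits, with the supremum norm; $\Delta f(t)=f(t)-f(t-)$ is the jump of $f\in D$ at $t$ (with $f(0-)=f(0)$). A map $X$ from a probability space $(\Omega,\mathcal F,P)$ to $D$ is $\mathcal D$-measurable if $X(t)$ is measurable for every $t\in[0,1]$. For a real Banach space $B$, with dual $B^*$, the injective tensor power $B^{\check\otimes k}$ is the closed linear span, in the space of bounded $k$-linear forms on $(B^*)^k$ with its usual norm, of the elementary tensors $x_1\otimes\cdots\otimes x_k:(\xi_1,\dots,\xi_k)\mapsto\xi_1(x_1)\cdots\xi_k(x_k)$; $x^{\otimes k}=x\otimes\cdots\otimes x$. A map $Y:\Omega\to B$ is Dunford integrable, with Dunford integral $E\,Y\in B^{**}$, if $\xi(Y)$ is integrable for every $\xi\in B^*$ and $\langle E\,Y,\xi\rangle=E\,\xi(Y)$; it is Pettis integrable if moreover the Dunford integrals of $Y$ and of $1_A Y$, for every $A\in\mathcal F$, belong to $B$. Bochner integrability has its usual meaning. The injective $k$-th moment $E X^{\check\otimes k}$ exists in the Dunford, Pettis or Bochner sense if $X^{\otimes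 k}$ is integrable in $D^{\check\otimes k}$ in that sense, and it is then this integral; the weak $k$-th moment exists if $E(\xi_1(X)\cdots\xi_k(X))$ exists (i.e. $\xi_1(X)\cdots\xi_k(X)$ is integrable) for all $\xi_1,\dots,\xi_k\in D^*$. Finally, $\hat I=\{t:0\le t\le1\}\cup\{t-:0<t\le1\}$ is the split interval, with the order topology for the order in which $s<t-<t$ whenever $s<t$, and $D([0,1]^k)$ is the Banach space, with the supremum norm, of the functions $[0,1]^k\to\mathbb R$ that have a continuous extension to $\hat I^k$. **Theorem.** Let $X$ be a $\mathcal D$-measurable $D[0,1]$-valued random variable and let $k\ge1$. (i) $E X^{\check\otimes k}$ exists in Dunford sense $\iff$ the weak $k$-th moment exists $\iff$ $\sup_{t\in[0,1]}E|X(t)|^k<\infty$. (ii) $E X^{\check\otimes k}$ exists in Pettis sense $\iff$ the family $\{|X(t)|^k:t\in[0,1]\}$ is uniformly integrable. (iii) $E X^{\check\otimes k}$ exists in Bochner sense $\iff$ $E\bigl[(\sup_{t\in[0,1]}|X(t)|)^k\bigr]<\infty$ and there is a (non-random) countable set $N\subset[0,1]$ such that almost surely $\{t:\Delta X(t)\ne0\}\subseteq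 N$. There is an isometric isomorphism $D^{\check\otimes k}\cong D([0,1]^k)$ that maps each elementary tensor $f_1\otimes\cdots\otimes f_k$ to the function $(t_1,\dots,t_k)\mapsto f_1(t_1)\cdots f_k(t_k)$. If $E X^{\check\otimes k}$ exists in Bochner or Pettis sense, then under this identification it is the function in $D([0,1]^k)$ given by $$E X^{\check\otimes k}(t_1,\dots,t_k)=E\bigl(X(t_1)\cdots X(t_k)\bigr),\qquad t_1,\dots,t_k\in[0,1],$$ where these expectations exist. -/

import Mathlib

open MeasureTheory Filter Set Topology
open scoped ENNReal unitInterval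

namespace CadlagMoment

noncomputable section

/-! ### The Banach space `D[0,1]` -/

/-- Right-continuous functions on `[0,1]` with left limits. At `t = 1` the first condition and at
`t = 0` the second condition is void. -/
def IsCadlag (f : I → ℝ) : Prop :=
  (∀ t, ContinuousWithinAt f (Ici t) t) ∧ ∀ t, ∃ l : ℝ, Tendsto f (𝓝[<] t) (𝓝 l)

/-- Every càdlàg function on `[0,1]` is bounded. -/
theorem IsCadlag.memℓp {f : I → ℝ} (hf : IsCadlag f) : Memℓp f ∞ := by
  have key : ∃ C : ℝ, ∀ t ∈ (univ : Set I), ‖f t‖ ≤ C := by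
    refine (isCompact_univ (X := I)).induction_on (p := fun s => ∃ C : ℝ, ∀ t ∈ s, ‖f t‖ ≤ C)
      ⟨0, by simp⟩ ?_ ?_ ?_
    · rintro s t hst ⟨C, hC⟩
      exact ⟨C, fun x hx => hC x (hst hx)⟩
    · rintro s t ⟨C, hC⟩ ⟨C', hC'⟩
      refine ⟨max C C', ?_⟩
      rintro x (hx | hx)
      · exact (hC x hx).trans (le_max_left _ _)
      · exact (hC' x hx).trans (le_max_right _ _)
    · intro t _
      obtain ⟨l, hl⟩ := hf.2 t
      have h1 : ∀ᶠ x in 𝓝[<] t, ‖f x‖ ≤ ‖l‖ + 1 :=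
        hl.norm.eventually (Iic_mem_nhds (by linarith))
      have h2 : ∀ᶠ x in 𝓝[≥] t, ‖f x‖ ≤ ‖f t‖ + 1 :=
        (hf.1 t).norm.eventually (Iic_mem_nhds (by linarith))
      rw [eventually_nhdsWithin_iff] at h1 h2
      refine ⟨{x | ‖f x‖ ≤ max (‖l‖ + 1) (‖f t‖ + 1)}, ?_, _, fun x hx => hx⟩
      rw [nhdsWithin_univ]
      filter_upwards [h1, h2] with x hx1 hx2
      rcases lt_or_ge x t with h | h
      · exact (hx1 h).trans (le_max_left _ _)
      · exact (hx2 h).trans (le_max_right _ _)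
  obtain ⟨C, hC⟩ := key
  refine memℓp_infty ⟨C, ?_⟩
  rintro _ ⟨t, rfl⟩
  exact hC t (mem_univ t)

/-- The càdlàg functions, as a linear subspace of the bounded functions on `[0,1]`. -/
def cadlagSubmodule : Submodule ℝ (lp (fun _ : I => ℝ) ∞) where
  carrier := {f | IsCadlag (f : I → ℝ)}
  add_mem' := by
    rintro f g ⟨hf1, hf2⟩ ⟨hg1, hg2⟩
    refine ⟨fun t => (hf1 t).add (hg1 t), fun t => ?_⟩
    obtain ⟨a, ha⟩ := hf2 t
    obtain ⟨b, hb⟩ := hg2 t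
    exact ⟨a + b, ha.add hb⟩
  zero_mem' := ⟨fun _ => continuousWithinAt_const, fun _ => ⟨0, tendsto_const_nhds⟩⟩
  smul_mem' := by
    rintro c f ⟨hf1, hf2⟩
    refine ⟨fun t => (hf1 t).const_smul c, fun t => ?_⟩
    obtain ⟨a, ha⟩ := hf2 t
    exact ⟨c • a, ha.const_smul c⟩

/-- The Banach space `D[0,1]` of càdlàg functions `[0,1] → ℝ` with the supremum norm. -/
abbrev DSpace : Type := cadlagSubmodule

instance : CoeFun DSpace fun _ => I → ℝ := ⟨fun f => (f : lp (fun _ : I => ℝ) ∞)⟩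

/-- A càdlàg function as an element of `D[0,1]`. -/
def DSpace.mk (f : I → ℝ) (hf : IsCadlag f) : DSpace := ⟨⟨f, hf.memℓp⟩, hf⟩

/-- The jump `Δf(t) = f(t) - f(t-)`, where `f(0-) = f(0)`. -/
def jump (f : I → ℝ) (t : I) : ℝ := f t - Function.leftLim f t

/-! ### The split interval and the Banach space `D([0,1]^k)` -/

/-- The split interval: the points `t- = (t, false)` for `0 < t ≤ 1` and `t = (t, true)` for
`0 ≤ t ≤ 1`, ordered lexicographically. -/
def SplitInterval : Type := {p : I ×ₗ Bool // p ≠ toLex ((0 : I), false)}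

instance : LinearOrder SplitInterval :=
  inferInstanceAs (LinearOrder {p : I ×ₗ Bool // p ≠ toLex ((0 : I), false)})

/-- The split interval carries the order topology. -/
instance : TopologicalSpace SplitInterval := Preorder.topology SplitInterval

instance : OrderTopology SplitInterval := ⟨rfl⟩

/-- The ordinary point `t` of the split interval. -/
def SplitInterval.ordinary (t : I) : SplitInterval := ⟨toLex (t, true), by simp⟩

/-- The functions on `[0,1]^k` that extend continuously to the `k`-th power of the split interval
(with the product topology), as a linear subspace of the bounded functions on `[0,1]^k`. Since the
split interval is compact, such functions are automatically bounded. -/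
def dPowSubmodule (k : ℕ) : Submodule ℝ (lp (fun _ : Fin k → I => ℝ) ∞) where
  carrier := {f | ∃ g : (Fin k → SplitInterval) → ℝ, Continuous g ∧
    ∀ t : Fin k → I, g (fun i => SplitInterval.ordinary (t i)) = f t}
  add_mem' := by
    rintro f₁ f₂ ⟨g₁, h₁, e₁⟩ ⟨g₂, h₂, e₂⟩
    exact ⟨fun x => g₁ x + g₂ x, h₁.add h₂, fun t => congrArg₂ (· + ·) (e₁ t) (e₂ t)⟩
  zero_mem' := ⟨fun _ => 0, continuous_const, fun _ => rfl⟩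
  smul_mem' := by
    rintro c f ⟨g, h, e⟩
    exact ⟨fun x => c • g x, h.const_smul c, fun t => congrArg (c • ·) (e t)⟩

/-- The Banach space `D([0,1]^k)`, with the supremum norm. -/
abbrev DPowSpace (k : ℕ) : Type := dPowSubmodule k

instance (k : ℕ) : CoeFun (DPowSpace k) fun _ => (Fin k → I) → ℝ :=
  ⟨fun f => (f : lp (fun _ : Fin k → I => ℝ) ∞)⟩

/-! ### Injective tensor powers -/

section Tensor

/-- The Banach space of bounded `k`-linear forms on `V`, with the norm
`‖u‖ = sup {|u(v₁, …, v_k)| : ‖vᵢ‖ ≤ 1}`. -/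
abbrev BoundedForm (V : Type*) [NormedAddCommGroup V] [NormedSpace ℝ V] (k : ℕ) : Type _ :=
  ContinuousMultilinearMap ℝ (fun _ : Fin k => V) ℝ

variable (B : Type*) [NormedAddCommGroup B] [NormedSpace ℝ B]

/-- The elementary tensor `x₁ ⊗ ⋯ ⊗ x_k`, regarded as the bounded `k`-linear form
`(ξ₁, …, ξ_k) ↦ ξ₁(x₁) ⋯ ξ_k(x_k)` on the dual of `B`. -/
def elementaryForm {k : ℕ} (x : Fin k → B) : BoundedForm (StrongDual ℝ B) k :=
  (ContinuousMultilinearMap.mkPiAlgebra ℝ (Fin k) ℝ).compContinuousLinearMap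
    fun i => NormedSpace.inclusionInDoubleDual ℝ B (x i)

/-- The injective tensor power: the closure of the linear span of the elementary tensors in the
space of bounded `k`-linear forms on the dual of `B`, with the norm of this space. -/
def injectiveSubmodule (k : ℕ) : Submodule ℝ (BoundedForm (StrongDual ℝ B) k) :=
  (Submodule.span ℝ (range fun x : Fin k → B => elementaryForm B x)).topologicalClosure

/-- The `k`-th injective tensor power of `B`, a Banach space. -/
def InjectiveTensorPower (k : ℕ) : Type _ := injectiveSubmodule B k

instance (k : ℕ) : NormedAddCommGroup (InjectiveTensorPower B k) :=
  inferInstanceAs (NormedAddCommGroup (injectiveSubmodule B k))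

instance (k : ℕ) : NormedSpace ℝ (InjectiveTensorPower B k) :=
  inferInstanceAs (NormedSpace ℝ (injectiveSubmodule B k))

instance (k : ℕ) : CompleteSpace (InjectiveTensorPower B k) :=
  inferInstanceAs (CompleteSpace (Submodule.topologicalClosure _ : Submodule ℝ _))

variable {B}

/-- The elementary tensor `x₁ ⊗ ⋯ ⊗ x_k` in the injective tensor power. -/
def elementaryTensor {k : ℕ} (x : Fin k → B) : InjectiveTensorPower B k :=
  ⟨elementaryForm B x, Submodule.le_topologicalClosure _ (Submodule.subset_span ⟨x, rfl⟩)⟩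

/-- The tensor power `x ⊗ ⋯ ⊗ x` in the injective tensor power. -/
def tensorPow (k : ℕ) (x : B) : InjectiveTensorPower B k := elementaryTensor fun _ => x

end Tensor

/-! ### The three vector-valued integrals -/

section Integrals

variable {Ω : Type*} [MeasurableSpace Ω] {B : Type*} [NormedAddCommGroup B] [NormedSpace ℝ B]

/-- `X` is Dunford integrable and its Dunford integral is the element `z` of the bidual. -/
def HasDunfordIntegral (X : Ω → B) (P : Measure Ω) (z : StrongDual ℝ (StrongDual ℝ B)) : Prop :=
  ∀ ξ : StrongDual ℝ B, Integrable (fun ω => ξ (X ω)) P ∧ z ξ = ∫ ω, ξ (X ω) ∂P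

/-- `X` is Pettis integrable and its Pettis integral is `z`: the Dunford integral of `X` is `z`, and
the Dunford integral of `1_E X` belongs to `B` for every measurable set `E`. -/
def HasPettisIntegral (X : Ω → B) (P : Measure Ω) (z : B) : Prop :=
  HasDunfordIntegral X P (NormedSpace.inclusionInDoubleDual ℝ B z) ∧
    ∀ E : Set Ω, MeasurableSet E →
      ∃ y : B, HasDunfordIntegral (E.indicator X) P (NormedSpace.inclusionInDoubleDual ℝ B y)

/-- `X` is Bochner integrable and its Bochner integral is `z`. -/
def HasBochnerIntegral [CompleteSpace B] (X : Ω → B) (P : Measure Ω) (z : B) : Prop :=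
  Integrable X P ∧ ∫ ω, X ω ∂P = z

end Integrals

section Moments

variable {Ω : Type*} [MeasurableSpace Ω] {B : Type*} [NormedAddCommGroup B] [NormedSpace ℝ B]

/-- The weak `k`-th moment of `X` exists: all expectations `E(ξ₁(X) ⋯ ξ_k(X))` exist. -/
def WeakMomentExists (X : Ω → B) (P : Measure Ω) (k : ℕ) : Prop :=
  ∀ ξ : Fin k → StrongDual ℝ B, Integrable (fun ω => ∏ i, ξ i (X ω)) P

/-- The injective `k`-th moment of `X` exists in Dunford sense and equals `z`. -/
def HasDunfordMoment (X : Ω → B) (P : Measure Ω) (k : ℕ)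
    (z : StrongDual ℝ (StrongDual ℝ (InjectiveTensorPower B k))) : Prop :=
  HasDunfordIntegral (fun ω => tensorPow k (X ω)) P z

/-- The injective `k`-th moment of `X` exists in Pettis sense and equals `z`. -/
def HasPettisMoment (X : Ω → B) (P : Measure Ω) (k : ℕ) (z : InjectiveTensorPower B k) : Prop :=
  HasPettisIntegral (fun ω => tensorPow k (X ω)) P z

/-- The injective `k`-th moment of `X` exists in Bochner sense and equals `z`. -/
def HasBochnerMoment (X : Ω → B) (P : Measure Ω) (k : ℕ) (z : InjectiveTensorPower B k) : Prop :=
  HasBochnerIntegral (fun ω => tensorPow k (X ω)) P z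

end Moments

end

end CadlagMoment

/-!
The split interval `Î` is compact, and a càdlàg function is the same thing as the restriction of a
continuous function on `Î` to the ordinary points. So `D[0,1]` is `C(Î)` and `D([0,1]^k)` is
`C(Î^k)`, isometrically. The injective tensor power of `D[0,1]` is also `C(Î^k)`, by evaluating
forms at point evaluations of `D[0,1]`: the supremum over point evaluations is the norm of the form
(`norm_le_of_evalAt`), and the products `f₁(τ₁) ⋯ f_k(τ_k)` span a dense subspace by the
Stone–Weierstrass theorem (`submodule_eq_top`).

The main tool is the rounding of the points of `Î` up to the first `n` points of a grid. It has
finite range, and composition with it is a contraction of `C(Î^k)`. A functional `ψ` on `C(Î^k)` charges at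
most countably many of the hyperplanes `τᵢ = t-`, and if the grid passes through the corresponding
points, then `ψ(G ∘ rounding) → ψ(G)` for all `G` (`exists_countable_tendsto_roundPow`). Thus `ψ` is
a limit of linear combinations of point evaluations with coefficients whose absolute values sum to
at most `‖ψ‖` (`exists_approx`). No integral representation of `ψ` is needed. For the tensor power of
the random function `X` it follows that `ψ(X ⊗ ⋯ ⊗ X)` is measurable and, by Fatou's lemma, that
`E|ψ(X ⊗ ⋯ ⊗ X)| ≤ k ‖ψ‖ sup_t E|X(t)|^k`, for every measure in place of the probability
(`lintegral_functional_le`).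

* Dunford sense: the bound gives the Dunford integral. Conversely, if the weak moment exists, a
  uniform boundedness argument with the moments `E|ξ(X)|^k` shows that they are bounded for
  `‖ξ‖ ≤ 1` (`WeakMomentExists.exists_bound`).
* Pettis sense: for bounded `X`, the function `τ ↦ E ∏ X(τᵢ)` on `Î^k` is continuous and is the
  Pettis integral, by dominated convergence. Under uniform integrability, these functions for the
  truncations of `X` converge uniformly (`exists_mean`). Conversely, Pettis integrability makes
  `E(1_E X(t)^k)` continuous in `t ∈ Î` for every event `E`, and as `Î` is sequentially compact, the
  Vitali–Hahn–Saks theorem (`vitali_hahn_saks`) yields uniform integrability.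
* Bochner sense: if the jumps occur in a countable set, the roundings of `X` for a grid through this
  set converge uniformly to `X` (`IsGrid.tendsto_comp_round`), so that `X` is strongly measurable.
  Conversely, a Bochner integrable function is almost surely separably valued, and the functions
  in a separable subset of `C(Î^k)` have all their jumps in a fixed countable set
  (`exists_countable_jumpsIn`).
-/

namespace CadlagMoment

noncomputable section

/-! ### The split interval -/

namespace SplitInterval

/-- The projection of the split interval onto `[0,1]` that sends both `t` and `t-` to `t`. -/
def val (τ : SplitInterval) : I := (ofLex τ.1).1

/-- The point `t-` of the split interval, for `t > 0`. -/
def minus (t : I) (ht : 0 < t) : SplitInterval :=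
  ⟨toLex (t, false), fun h => ht.ne' (congrArg (fun p => (ofLex p).1) h)⟩

theorem cases (τ : SplitInterval) : (∃ t, τ = ordinary t) ∨ ∃ t ht, τ = minus t ht := by
  obtain ⟨p, hp⟩ := τ
  obtain ⟨t, b⟩ := p
  cases b
  · right
    refine ⟨t, ?_, rfl⟩
    rcases eq_or_lt_of_le (unitInterval.nonneg' (t := t)) with h | h
    · exact absurd (by rw [h]; rfl) hp
    · exact h
  · exact Or.inl ⟨t, rfl⟩

@[simp] theorem val_ordinary (t : I) : val (ordinary t) = t := rfl

@[simp] theorem val_minus (t : I) (ht : 0 < t) : val (minus t ht) = t := rfl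

theorem le_iff {ρ τ : SplitInterval} :
    ρ ≤ τ ↔ val ρ < val τ ∨ val ρ = val τ ∧ (ofLex ρ.1).2 ≤ (ofLex τ.1).2 :=
  Prod.Lex.le_iff (x := ρ.1) (y := τ.1)

theorem lt_iff {ρ τ : SplitInterval} :
    ρ < τ ↔ val ρ < val τ ∨ val ρ = val τ ∧ (ofLex ρ.1).2 < (ofLex τ.1).2 :=
  Prod.Lex.lt_iff (x := ρ.1) (y := τ.1)

theorem val_mono : Monotone val := fun ρ τ h => by
  rcases le_iff.1 h with h | h
  exacts [h.le, h.1.le]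

theorem lt_of_val_lt {ρ τ : SplitInterval} (h : val ρ < val τ) : ρ < τ := lt_iff.2 (Or.inl h)

theorem le_ordinary_iff {ρ : SplitInterval} {t : I} : ρ ≤ ordinary t ↔ val ρ ≤ t := by
  refine ⟨fun h => val_mono h, fun h => le_iff.2 ?_⟩
  rcases h.lt_or_eq with h | h
  · exact Or.inl h
  · exact Or.inr ⟨h, by simp [ordinary]⟩

theorem ordinary_lt_iff {ρ : SplitInterval} {t : I} : ordinary t < ρ ↔ t < val ρ := by
  rw [← not_le, le_ordinary_iff, not_le]

theorem minus_le_iff {ρ : SplitInterval} {t : I} {ht : 0 < t} : minus t ht ≤ ρ ↔ t ≤ val ρ := by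
  refine ⟨fun h => val_mono h, fun h => le_iff.2 ?_⟩
  rcases h.lt_or_eq with h | h
  · exact Or.inl h
  · exact Or.inr ⟨h, by simp [minus]⟩

theorem lt_minus_iff {ρ : SplitInterval} {t : I} {ht : 0 < t} : ρ < minus t ht ↔ val ρ < t := by
  rw [← not_le, minus_le_iff, not_le]

theorem minus_lt_ordinary (t : I) (ht : 0 < t) : minus t ht < ordinary t :=
  lt_iff.2 (Or.inr ⟨rfl, by simp [ordinary, minus]⟩)

/-- There is no point strictly between `t-` and `t`. -/
theorem minus_lt_iff {ρ : SplitInterval} {t : I} {ht : 0 < t} :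
    minus t ht < ρ ↔ ordinary t ≤ ρ := by
  refine ⟨fun h => ?_, fun h => (minus_lt_ordinary t ht).trans_le h⟩
  rcases lt_iff.1 h with h | ⟨h1, h2⟩
  · exact le_iff.2 (Or.inl h)
  · refine le_iff.2 (Or.inr ⟨h1, ?_⟩)
    simp only [minus, ofLex_toLex] at h2
    simp only [ordinary, ofLex_toLex]
    revert h2
    cases (ofLex ρ.1).2 <;> simp

theorem lt_ordinary_iff {ρ : SplitInterval} {t : I} {ht : 0 < t} :
    ρ < ordinary t ↔ ρ ≤ minus t ht := by
  rw [← not_le, ← minus_lt_iff (ht := ht), not_lt]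

theorem ordinary_zero_le (τ : SplitInterval) : ordinary 0 ≤ τ := by
  rcases cases τ with ⟨t, rfl⟩ | ⟨t, ht, rfl⟩
  · exact le_ordinary_iff.2 unitInterval.nonneg'
  · exact (lt_minus_iff.2 ht).le

instance : OrderTop SplitInterval where
  top := ordinary 1
  le_top _ := le_ordinary_iff.2 unitInterval.le_one'

instance : Nonempty SplitInterval := ⟨⊤⟩

theorem continuous_val : Continuous val :=
  val_mono.continuous_of_surjective fun t => ⟨ordinary t, rfl⟩

theorem isClopen_Ici_ordinary (t : I) : IsClopen (Ici (ordinary t)) := by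
  refine ⟨isClosed_Ici, ?_⟩
  rcases eq_or_lt_of_le (unitInterval.nonneg' (t := t)) with rfl | h
  · rw [(eq_univ_iff_forall.2 ordinary_zero_le : Ici (ordinary 0) = univ)]
    exact isOpen_univ
  · have : Ici (ordinary t) = Ioi (minus t h) := by
      ext; exact minus_lt_iff.symm
    rw [this]
    exact isOpen_Ioi

theorem isClopen_Iic_minus (t : I) (ht : 0 < t) : IsClopen (Iic (minus t ht)) := by
  refine ⟨isClosed_Iic, ?_⟩
  have : Iic (minus t ht) = Iio (ordinary t) := by
    ext; exact lt_ordinary_iff.symm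
  rw [this]
  exact isOpen_Iio

theorem nhds_ordinary (t : I) :
    𝓝 (ordinary t) = comap val (𝓝 t) ⊓ 𝓟 (Ici (ordinary t)) := by
  refine le_antisymm (le_inf continuous_val.continuousAt.le_comap
    (le_principal_iff.2 ((isClopen_Ici_ordinary t).2.mem_nhds self_mem_Ici))) ?_
  rw [nhds_eq_order (ordinary t)]
  refine le_inf (le_iInf₂ fun ρ hr => le_principal_iff.2 ?_)
    (le_iInf₂ fun ρ hr => le_principal_iff.2 ?_)
  · exact mem_inf_of_right (mem_principal.2 fun x hx =>
      mem_Ioi.2 ((mem_Iio.1 hr).trans_le (mem_Ici.1 hx)))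
  · exact mem_inf_of_left
      ⟨Iio (val ρ), Iio_mem_nhds (ordinary_lt_iff.1 hr), fun x hx => lt_of_val_lt hx⟩

theorem nhds_minus (t : I) (ht : 0 < t) :
    𝓝 (minus t ht) = comap val (𝓝 t) ⊓ 𝓟 (Iic (minus t ht)) := by
  refine le_antisymm (le_inf continuous_val.continuousAt.le_comap
    (le_principal_iff.2 ((isClopen_Iic_minus t ht).2.mem_nhds self_mem_Iic))) ?_
  rw [nhds_eq_order (minus t ht)]
  refine le_inf (le_iInf₂ fun ρ hr => le_principal_iff.2 ?_)
    (le_iInf₂ fun ρ hr => le_principal_iff.2 ?_)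
  · exact mem_inf_of_left
      ⟨Ioi (val ρ), Ioi_mem_nhds (lt_minus_iff.1 hr), fun x hx => lt_of_val_lt hx⟩
  · exact mem_inf_of_right (mem_principal.2 fun x hx =>
      mem_Iio.2 ((mem_Iic.1 hx).trans_lt (mem_Ioi.1 hr)))

/-- If the projections to `[0,1]` converge to `t`, then the only possible limits in the split interval
are `t-` and `t`. -/
theorem comap_val_le (t : I) (ht : 0 < t) :
    comap val (𝓝 t) ≤ 𝓝 (minus t ht) ⊔ 𝓝 (ordinary t) := by
  rw [nhds_minus, nhds_ordinary, ← inf_sup_left, sup_principal]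
  refine le_inf le_rfl (le_principal_iff.2 (univ_mem' fun x => ?_))
  rcases le_or_gt x (minus t ht) with h | h
  exacts [Or.inl h, Or.inr (minus_lt_iff.1 h)]

instance : CompactSpace SplitInterval := by
  refine ⟨isCompact_iff_ultrafilter_le_nhds.2 fun F _ => ?_⟩
  obtain ⟨t, -, ht⟩ := isCompact_iff_ultrafilter_le_nhds.1 (isCompact_univ (X := I))
    (F.map val) (by simp)
  have h1 : (F : Filter SplitInterval) ≤ comap val (𝓝 t) := map_le_iff_le_comap.1 ht
  by_cases h : Ici (ordinary t) ∈ F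
  · exact ⟨ordinary t, mem_univ _, by
      rw [nhds_ordinary]; exact le_inf h1 (le_principal_iff.2 h)⟩
  · have h2 := Ultrafilter.compl_mem_iff_notMem.2 h
    have ht0 : 0 < t := by
      obtain ⟨x, hx⟩ := F.nonempty_of_mem h2
      by_contra h0
      have : t = 0 := le_antisymm (not_lt.1 h0) unitInterval.nonneg'
      exact hx (this ▸ ordinary_zero_le x)
    refine ⟨minus t ht0, mem_univ _, ?_⟩
    rw [nhds_minus]
    refine le_inf h1 (le_principal_iff.2 (mem_of_superset h2 fun x hx => ?_))
    exact lt_ordinary_iff.1 (not_le.1 hx)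

instance : FirstCountableTopology SplitInterval := by
  refine ⟨fun τ => ?_⟩
  rcases cases τ with ⟨t, rfl⟩ | ⟨t, ht, rfl⟩
  · rw [nhds_ordinary]; infer_instance
  · rw [nhds_minus]; infer_instance

theorem continuousWithinAt_ordinary (t : I) : ContinuousWithinAt ordinary (Ici t) t := by
  rw [ContinuousWithinAt, nhds_ordinary, tendsto_inf, tendsto_comap_iff, tendsto_principal]
  refine ⟨tendsto_nhdsWithin_of_tendsto_nhds tendsto_id, ?_⟩
  filter_upwards [self_mem_nhdsWithin] with x hx
  exact le_ordinary_iff.2 hx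

theorem tendsto_ordinary_minus (t : I) (ht : 0 < t) :
    Tendsto ordinary (𝓝[<] t) (𝓝 (minus t ht)) := by
  rw [nhds_minus, tendsto_inf, tendsto_comap_iff, tendsto_principal]
  refine ⟨tendsto_nhdsWithin_of_tendsto_nhds tendsto_id, ?_⟩
  filter_upwards [self_mem_nhdsWithin] with x hx
  exact (lt_minus_iff.2 hx).le

theorem nhdsLT_neBot {t : I} (ht : 0 < t) : (𝓝[<] t).NeBot :=
  nhdsLT_neBot_of_exists_lt ⟨0, ht⟩

theorem dense_image_ordinary {Q : Set I} (hQ : Dense Q) (h1 : (1 : I) ∈ Q) :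
    Dense (ordinary '' Q) := by
  have hlt : ∀ {s u : I}, s < u → ∃ q ∈ Q, s < q ∧ q < u := fun h => by
    obtain ⟨q, hq, h⟩ := hQ.exists_between h
    exact ⟨q, hq, h⟩
  intro τ
  rw [mem_closure_iff_nhds]
  intro U hU
  rcases cases τ with ⟨t, rfl⟩ | ⟨t, ht, rfl⟩
  · rcases eq_or_lt_of_le (unitInterval.le_one' (t := t)) with rfl | h
    · exact ⟨_, mem_of_mem_nhds hU, mem_image_of_mem _ h1⟩
    · rw [nhds_ordinary, mem_inf_principal, mem_comap] at hU
      obtain ⟨V, hV, hU⟩ := hU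
      obtain ⟨b, hb, hb'⟩ := exists_Ico_subset_of_mem_nhds hV ⟨1, h⟩
      obtain ⟨q, hq, h1, h2⟩ := hlt hb
      exact ⟨ordinary q, hU (hb' ⟨h1.le, h2⟩) (le_ordinary_iff.2 h1.le), q, hq, rfl⟩
  · rw [nhds_minus, mem_inf_principal, mem_comap] at hU
    obtain ⟨V, hV, hU⟩ := hU
    obtain ⟨b, hb, hb'⟩ := exists_Ioc_subset_of_mem_nhds hV ⟨0, ht⟩
    obtain ⟨q, hq, h1, h2⟩ := hlt hb
    exact ⟨ordinary q, hU (hb' ⟨h1, h2.le⟩) (lt_minus_iff.2 h2).le, q, hq, rfl⟩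

theorem denseRange_ordinary : DenseRange ordinary := by
  rw [DenseRange, ← image_univ]
  exact dense_image_ordinary dense_univ (mem_univ _)

theorem denseRange_ordinary_pow (k : ℕ) :
    DenseRange fun (t : Fin k → I) i => ordinary (t i) :=
  DenseRange.piMap fun _ => denseRange_ordinary

end SplitInterval

open SplitInterval

/-! ### Càdlàg functions as continuous functions on the split interval -/

/-- A bounded function on a dense subset of a compact space that is the restriction of a continuous
function has the same supremum norm as the latter. -/
theorem norm_eq_of_denseRange {T K : Type*} [TopologicalSpace K] [CompactSpace K] {e : T → K}
    (he : DenseRange e) (g : C(K, ℝ)) (F : lp (fun _ : T => ℝ) ∞) (h : ∀ t, F t = g (e t)) :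
    ‖F‖ = ‖g‖ := by
  refine le_antisymm (lp.norm_le_of_forall_le (norm_nonneg _) fun t => ?_) ?_
  · rw [h]; exact g.norm_coe_le_norm _
  · refine (ContinuousMap.norm_le _ (norm_nonneg _)).2 fun x => ?_
    refine he.induction_on (p := fun x => ‖g x‖ ≤ ‖F‖) x
      (isClosed_le (map_continuous g).norm continuous_const) fun t => ?_
    rw [← h]; exact lp.norm_apply_le_norm (by simp) F t

theorem isCadlag_comp_ordinary (g : C(SplitInterval, ℝ)) : IsCadlag fun t => g (ordinary t) := by
  refine ⟨fun t => ?_, fun t => ?_⟩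
  · exact (map_continuous g).continuousAt.comp_continuousWithinAt (continuousWithinAt_ordinary t)
  · rcases eq_or_lt_of_le (unitInterval.nonneg' (t := t)) with rfl | h
    · refine ⟨0, ?_⟩
      have : Iio (0 : I) = ∅ := by
        ext x; simp
      rw [this, nhdsWithin_empty]
      exact tendsto_bot
    · exact ⟨g (minus t h),
        ((map_continuous g).tendsto _).comp (tendsto_ordinary_minus t h)⟩

/-- The extension of a function on `[0,1]` to the split interval by its left limits. -/
def extendFun (f : I → ℝ) (τ : SplitInterval) : ℝ :=
  if (ofLex τ.1).2 then f (val τ) else Function.leftLim f (val τ)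

@[simp] theorem extendFun_ordinary (f : I → ℝ) (t : I) : extendFun f (ordinary t) = f t := rfl

@[simp] theorem extendFun_minus (f : I → ℝ) (t : I) (ht : 0 < t) :
    extendFun f (minus t ht) = Function.leftLim f t := rfl

theorem IsCadlag.continuous_extendFun {f : I → ℝ} (hf : IsCadlag f) :
    Continuous (extendFun f) := by
  have hlim : ∀ t, Tendsto f (𝓝[<] t) (𝓝 (Function.leftLim f t)) := fun t =>
    tendsto_leftLim_of_tendsto (hf.2 t)
  -- a left limit at `s` belongs to a closed set that contains the values of `f` on the left of `s`
  have hmem : ∀ (C : Set ℝ), IsClosed C → ∀ s : I, 0 < s → (∀ᶠ r in 𝓝[<] s, f r ∈ C) →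
      Function.leftLim f s ∈ C := fun C hC s hs h =>
    have := nhdsLT_neBot hs
    hC.mem_of_tendsto (hlim s) h
  refine continuous_iff_continuousAt.2 fun τ => ?_
  rw [ContinuousAt, (closed_nhds_basis _).tendsto_right_iff]
  rintro C ⟨hC, hCc⟩
  rcases cases τ with ⟨t, rfl⟩ | ⟨t, ht, rfl⟩
  · have h1 := (hf.1 t).eventually (p := (· ∈ C)) hC
    rw [eventually_iff, mem_nhdsWithin] at h1
    obtain ⟨U, hU, htU, hUC⟩ := h1
    rw [nhds_ordinary, eventually_inf_principal]
    filter_upwards [preimage_mem_comap (hU.mem_nhds htU)] with ρ hρ hρ'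
    rcases cases ρ with ⟨s, rfl⟩ | ⟨s, hs, rfl⟩
    · exact hUC ⟨hρ, le_ordinary_iff.1 hρ'⟩
    · have hts : t < s := by
        by_contra h
        exact (not_le.2 (minus_lt_ordinary s hs)) ((le_ordinary_iff.2 (not_lt.1 h)).trans hρ')
      refine hmem C hCc s hs ?_
      filter_upwards [nhdsWithin_le_nhds (hU.mem_nhds hρ), nhdsWithin_le_nhds (Ioi_mem_nhds hts)]
        with r h1 h2
      exact hUC ⟨h1, (mem_Ioi.1 h2).le⟩
  · have h1 := (hlim t).eventually (p := (· ∈ C)) hC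
    rw [eventually_iff, mem_nhdsWithin] at h1
    obtain ⟨U, hU, htU, hUC⟩ := h1
    rw [nhds_minus, eventually_inf_principal]
    filter_upwards [preimage_mem_comap (hU.mem_nhds htU)] with ρ hρ hρ'
    rcases cases ρ with ⟨s, rfl⟩ | ⟨s, hs, rfl⟩
    · refine hUC ⟨hρ, ?_⟩
      by_contra h
      exact (not_le.2 (minus_lt_ordinary t ht)) ((le_ordinary_iff.2 (not_lt.1 h)).trans hρ')
    · refine hmem C hCc s hs ?_
      filter_upwards [nhdsWithin_le_nhds (hU.mem_nhds hρ), self_mem_nhdsWithin]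
        with r h1 h2
      exact hUC ⟨h1, lt_of_lt_of_le h2 (val_mono hρ')⟩

/-- The isometric isomorphism `C(Î) ≃ D[0,1]` given by restriction to the ordinary points of the
split interval `Î`. -/
def cadlagEquiv : C(SplitInterval, ℝ) ≃ₗᵢ[ℝ] DSpace :=
  LinearIsometryEquiv.ofSurjective
    { toFun := fun g => DSpace.mk _ (isCadlag_comp_ordinary g)
      map_add' := fun _ _ => rfl
      map_smul' := fun _ _ => rfl
      norm_map' := fun g => norm_eq_of_denseRange denseRange_ordinary g _ fun _ => rfl }
    fun f => ⟨⟨_, f.2.continuous_extendFun⟩, rfl⟩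

@[simp] theorem cadlagEquiv_apply (g : C(SplitInterval, ℝ)) (t : I) :
    cadlagEquiv g t = g (ordinary t) := rfl

/-- The continuous extension of a càdlàg function to the split interval. -/
def extend : DSpace ≃ₗᵢ[ℝ] C(SplitInterval, ℝ) := cadlagEquiv.symm

@[simp] theorem extend_ordinary (f : DSpace) (t : I) : extend f (ordinary t) = f t := by
  rw [← cadlagEquiv_apply, extend, LinearIsometryEquiv.apply_symm_apply]

theorem extend_minus (f : DSpace) (t : I) (ht : 0 < t) :
    extend f (minus t ht) = Function.leftLim f t := by
  have := nhdsLT_neBot ht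
  refine (leftLim_eq_of_tendsto ?_).symm
  have := ((map_continuous (extend f)).tendsto _).comp (tendsto_ordinary_minus t ht)
  simpa [Function.comp_def] using this

/-- The isometric isomorphism `C(Î^k) ≃ D([0,1]^k)` given by restriction to the ordinary points. -/
def cadlagPowEquiv (k : ℕ) : C(Fin k → SplitInterval, ℝ) ≃ₗᵢ[ℝ] DPowSpace k :=
  LinearIsometryEquiv.ofSurjective
    { toFun := fun g => ⟨⟨fun t => g fun i => ordinary (t i), memℓp_infty
        ⟨‖g‖, by rintro _ ⟨t, rfl⟩; exact g.norm_coe_le_norm _⟩⟩, g, map_continuous g, fun _ => rfl⟩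
      map_add' := fun _ _ => rfl
      map_smul' := fun _ _ => rfl
      norm_map' := fun g => norm_eq_of_denseRange (denseRange_ordinary_pow k) g _ fun _ => rfl }
    fun f => by
      obtain ⟨g, hg, h⟩ := f.2
      exact ⟨⟨g, hg⟩, Subtype.ext (lp.ext (funext h))⟩

@[simp] theorem cadlagPowEquiv_apply {k : ℕ} (g : C(Fin k → SplitInterval, ℝ)) (t : Fin k → I) :
    cadlagPowEquiv k g t = g fun i => ordinary (t i) := rfl

/-! ### Density of products of step functions -/

/-- The indicator function of a clopen set. -/
def clopenIndicator {K : Type*} [TopologicalSpace K] {A : Set K} (hA : IsClopen A) : C(K, ℝ) :=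
  ⟨A.indicator fun _ => 1, hA.continuous_indicator continuous_const⟩

/-- The function `τ ↦ 1_{τ ≥ a}` on the split interval. -/
def step (a : I) : C(SplitInterval, ℝ) := clopenIndicator (isClopen_Ici_ordinary a)

theorem step_of_le {a : I} {τ : SplitInterval} (h : ordinary a ≤ τ) : step a τ = 1 :=
  indicator_of_mem (s := Ici (ordinary a)) h fun _ => (1 : ℝ)

theorem step_of_lt {a : I} {τ : SplitInterval} (h : τ < ordinary a) : step a τ = 0 :=
  indicator_of_notMem (s := Ici (ordinary a)) (not_le.2 h) fun _ => (1 : ℝ)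

variable {k : ℕ}

/-- The function `τ ↦ 1_{τᵢ ≥ a}` on the `k`-th power of the split interval. -/
def stepAt (i : Fin k) (a : I) : C(Fin k → SplitInterval, ℝ) :=
  (step a).comp ⟨fun τ => τ i, continuous_apply i⟩

@[simp] theorem stepAt_apply (i : Fin k) (a : I) (τ : Fin k → SplitInterval) :
    stepAt i a τ = step a (τ i) := rfl

theorem exists_step_ne {ρ τ : SplitInterval} (h : ρ < τ) : ∃ a, step a ρ ≠ step a τ := by
  obtain ⟨a, h1, h2⟩ : ∃ a, ρ < ordinary a ∧ ordinary a ≤ τ := by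
    rcases cases τ with ⟨t, rfl⟩ | ⟨t, ht, rfl⟩
    · exact ⟨t, h, le_rfl⟩
    · obtain ⟨a, h1, h2⟩ := exists_between (lt_minus_iff.1 h)
      exact ⟨a, lt_of_val_lt h1, (lt_minus_iff.2 h2).le⟩
  exact ⟨a, by rw [step_of_lt h1, step_of_le h2]; exact zero_ne_one⟩

/-- Stone–Weierstrass: the functions `1_{τᵢ ≥ a}` separate the points of the compact space `Î^k`. -/
theorem subalgebra_eq_top (A : Subalgebra ℝ C(Fin k → SplitInterval, ℝ))
    (hA : IsClosed (A : Set C(Fin k → SplitInterval, ℝ))) (h : ∀ i a, stepAt i a ∈ A) :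
    A = ⊤ := by
  have hsep : A.SeparatesPoints := by
    intro ρ τ hne
    obtain ⟨i, hi⟩ := Function.ne_iff.1 hne
    obtain ⟨a, ha⟩ : ∃ a, step a (ρ i) ≠ step a (τ i) := by
      rcases lt_or_gt_of_ne hi with h | h
      · exact exists_step_ne h
      · obtain ⟨a, ha⟩ := exists_step_ne h
        exact ⟨a, ha.symm⟩
    exact ⟨stepAt i a, ⟨stepAt i a, h i a, rfl⟩, ha⟩
  rw [← ContinuousMap.subalgebra_topologicalClosure_eq_top_of_separatesPoints A hsep]
  exact SetLike.coe_injective (by rw [Subalgebra.topologicalClosure_coe, hA.closure_eq])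

/-- The function `(τ₁, …, τ_k) ↦ f₁(τ₁) ⋯ f_k(τ_k)`. -/
def prodMap (f : Fin k → C(SplitInterval, ℝ)) : C(Fin k → SplitInterval, ℝ) :=
  ⟨fun τ => ∏ i, f i (τ i), by fun_prop⟩

@[simp] theorem prodMap_apply (f : Fin k → C(SplitInterval, ℝ)) (τ : Fin k → SplitInterval) :
    prodMap f τ = ∏ i, f i (τ i) := rfl

theorem submodule_eq_top (W : Submodule ℝ C(Fin k → SplitInterval, ℝ))
    (hW : IsClosed (W : Set C(Fin k → SplitInterval, ℝ))) (h : ∀ f, prodMap f ∈ W) :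
    W = ⊤ := by
  let S : Set C(Fin k → SplitInterval, ℝ) := {G | ∃ i a, G = stepAt i a}
  let M : Submonoid C(Fin k → SplitInterval, ℝ) :=
    { carrier := range prodMap
      one_mem' := ⟨fun _ => 1, by ext; simp⟩
      mul_mem' := by
        rintro _ _ ⟨f, rfl⟩ ⟨g, rfl⟩
        exact ⟨fun i => f i * g i, by ext; simp [Finset.prod_mul_distrib]⟩ }
  have hSM : Submonoid.closure S ≤ M := by
    rw [Submonoid.closure_le]
    rintro _ ⟨i, a, rfl⟩
    refine ⟨fun j => if j = i then step a else 1, ?_⟩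
    ext τ
    rw [prodMap_apply, Finset.prod_eq_single i (by intro j _ hj; simp [hj]) (by simp)]
    simp
  have h1 : Subalgebra.toSubmodule (Algebra.adjoin ℝ S) ≤ W := by
    rw [Algebra.adjoin_eq_span, Submodule.span_le]
    intro G hG
    obtain ⟨f, rfl⟩ := hSM hG
    exact h f
  have h2 : (Algebra.adjoin ℝ S).topologicalClosure = ⊤ :=
    subalgebra_eq_top _ (Subalgebra.isClosed_topologicalClosure _) fun i a =>
      Subalgebra.le_topologicalClosure _ (Algebra.subset_adjoin ⟨i, a, rfl⟩)
  refine eq_top_iff.2 fun G _ => ?_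
  have h3 : G ∈ (Algebra.adjoin ℝ S).topologicalClosure := h2 ▸ Algebra.mem_top
  exact closure_minimal h1 hW h3

/-! ### The injective tensor power of `D[0,1]` -/

/-- The evaluation of càdlàg functions at a point of the split interval. -/
def evalAt (τ : SplitInterval) : StrongDual ℝ DSpace :=
  (ContinuousMap.evalCLM ℝ τ).comp (extend : DSpace →L[ℝ] C(SplitInterval, ℝ))

@[simp] theorem evalAt_apply (τ : SplitInterval) (f : DSpace) : evalAt τ f = extend f τ := rfl

theorem norm_evalAt_le (τ : SplitInterval) : ‖evalAt τ‖ ≤ 1 := by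
  refine ContinuousLinearMap.opNorm_le_bound _ zero_le_one fun f => ?_
  rw [one_mul, ← extend.norm_map f]
  exact (extend f).norm_coe_le_norm τ

@[simp] theorem elementaryForm_apply {B : Type*} [NormedAddCommGroup B] [NormedSpace ℝ B]
    (x : Fin k → B) (ξ : Fin k → StrongDual ℝ B) :
    elementaryForm B x ξ = ∏ i, ξ i (x i) := by
  simp [elementaryForm]

/-- The span of the elementary tensors consists of forms that are, in each variable
separately, given by an element of the space. -/
theorem exists_slice {B : Type*} [NormedAddCommGroup B] [NormedSpace ℝ B]
    {u : BoundedForm (StrongDual ℝ B) k}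
    (hu : u ∈ Submodule.span ℝ (range fun x : Fin k → B => elementaryForm B x))
    (ξ : Fin k → StrongDual ℝ B) (j : Fin k) :
    ∃ x : B, ∀ η, u (Function.update ξ j η) = η x := by
  induction hu using Submodule.span_induction with
  | mem u hu =>
    obtain ⟨x, rfl⟩ := hu
    refine ⟨(∏ i ∈ Finset.univ.erase j, ξ i (x i)) • x j, fun η => ?_⟩
    simp only [elementaryForm_apply, map_smul, smul_eq_mul]
    rw [← Finset.prod_erase_mul _ _ (Finset.mem_univ j), Function.update_self]
    congr 1
    refine Finset.prod_congr rfl fun i hi => ?_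
    rw [Function.update_of_ne (Finset.ne_of_mem_erase hi)]
  | zero => exact ⟨0, by simp⟩
  | add u v _ _ hu hv =>
    obtain ⟨x, hx⟩ := hu
    obtain ⟨y, hy⟩ := hv
    exact ⟨x + y, fun η => by
      rw [add_apply, hx, hy, map_add]⟩
  | smul c u _ hu =>
    obtain ⟨x, hx⟩ := hu
    exact ⟨c • x, fun η => by
      rw [smul_apply, hx, map_smul]⟩

theorem BoundedForm.norm_apply_le {V : Type*} [NormedAddCommGroup V] [NormedSpace ℝ V]
    (u : BoundedForm V k) (ξ : Fin k → V) : ‖u ξ‖ ≤ ‖u‖ * ∏ i, ‖ξ i‖ :=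
  u.le_opNorm ξ

theorem BoundedForm.norm_le {V : Type*} [NormedAddCommGroup V] [NormedSpace ℝ V]
    (u : BoundedForm V k) {C : ℝ} (hC : 0 ≤ C) (h : ∀ ξ, ‖u ξ‖ ≤ C * ∏ i, ‖ξ i‖) : ‖u‖ ≤ C :=
  u.opNorm_le_bound hC h

theorem exists_span_near {B : Type*} [NormedAddCommGroup B] [NormedSpace ℝ B]
    {u : BoundedForm (StrongDual ℝ B) k} (hu : u ∈ injectiveSubmodule B k) {ε : ℝ} (hε : 0 < ε) :
    ∃ v ∈ Submodule.span ℝ (range fun x : Fin k → B => elementaryForm B x), ‖u - v‖ < ε := by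
  obtain ⟨v, hv, hvu⟩ := Metric.mem_closure_iff.1 hu ε hε
  exact ⟨v, hv, by rwa [dist_eq_norm] at hvu⟩

/-- A bound for a form at the point evaluations is a bound for its norm: replace the point
evaluations by arbitrary functionals, one variable at a time. -/
theorem norm_le_of_evalAt {u : BoundedForm (StrongDual ℝ DSpace) k}
    (hu : u ∈ Submodule.span ℝ (range fun x : Fin k → DSpace => elementaryForm DSpace x))
    {C : ℝ} (hC : 0 ≤ C) (h : ∀ τ : Fin k → SplitInterval, ‖u fun i => evalAt (τ i)‖ ≤ C) :
    ‖u‖ ≤ C := by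
  have key : ∀ (S : Finset (Fin k)) (ξ : Fin k → StrongDual ℝ DSpace),
      (∀ i ∉ S, ∃ τ, ξ i = evalAt τ) → ‖u ξ‖ ≤ C * ∏ i ∈ S, ‖ξ i‖ := by
    intro S
    induction S using Finset.induction_on with
    | empty =>
      intro ξ hξ
      choose τ hτ using fun i => hξ i (by simp)
      simpa [← funext hτ] using h τ
    | insert j S hj ih =>
      intro ξ hξ
      obtain ⟨x, hx⟩ := exists_slice hu ξ j
      have h1 : ‖x‖ ≤ C * ∏ i ∈ S, ‖ξ i‖ := by
        rw [← extend.norm_map x]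
        refine (ContinuousMap.norm_le _ (by positivity)).2 fun τ => ?_
        rw [← evalAt_apply, ← hx]
        have hS : ∏ i ∈ S, ‖ξ i‖ = ∏ i ∈ S, ‖Function.update ξ j (evalAt τ) i‖ :=
          Finset.prod_congr rfl fun i hi => by
            rw [Function.update_of_ne (ne_of_mem_of_not_mem hi hj)]
        rw [hS]
        refine ih _ fun i hi => ?_
        rcases eq_or_ne i j with rfl | hij
        · exact ⟨τ, by simp⟩
        · rw [Function.update_of_ne hij]
          exact hξ i (by simp [hij, hi])
      have h2 : u ξ = ξ j x := by rw [← hx, Function.update_eq_self]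
      rw [h2, Finset.prod_insert hj, mul_left_comm]
      exact ((ξ j).le_opNorm x).trans (by gcongr)
  refine BoundedForm.norm_le u hC fun ξ => ?_
  exact key Finset.univ ξ (by simp)

theorem norm_evalAt_form_le (u : BoundedForm (StrongDual ℝ DSpace) k)
    (τ : Fin k → SplitInterval) : ‖u fun i => evalAt (τ i)‖ ≤ ‖u‖ := by
  refine (BoundedForm.norm_apply_le u _).trans (mul_le_of_le_one_right (norm_nonneg _) ?_)
  exact Finset.prod_le_one (fun i _ => norm_nonneg (evalAt (τ i))) fun i _ => norm_evalAt_le _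

theorem continuous_evalAt_form {u : BoundedForm (StrongDual ℝ DSpace) k}
    (hu : u ∈ injectiveSubmodule DSpace k) :
    Continuous fun τ : Fin k → SplitInterval => u fun i => evalAt (τ i) := by
  have hspan : ∀ v ∈ Submodule.span ℝ (range fun x : Fin k → DSpace => elementaryForm DSpace x),
      Continuous fun τ : Fin k → SplitInterval => v fun i => evalAt (τ i) := by
    intro v hv
    induction hv using Submodule.span_induction with
    | mem u hu =>
      obtain ⟨x, rfl⟩ := hu
      simp only [elementaryForm_apply, evalAt_apply]
      fun_prop
    | zero => exact continuous_const
    | add u v _ _ hu hv => exact hu.add hv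
    | smul c u _ hu => exact hu.const_smul c
  refine continuous_of_uniform_approx_of_continuous fun s hs => ?_
  obtain ⟨ε, hε, hs⟩ := Metric.mem_uniformity_dist.1 hs
  obtain ⟨v, hv, hvu⟩ := exists_span_near hu hε
  refine ⟨_, hspan v hv, fun τ => hs ?_⟩
  rw [dist_eq_norm, ← sub_apply]
  exact (norm_evalAt_form_le _ τ).trans_lt hvu

/-- The isometric isomorphism of the injective tensor power of `D[0,1]` with `C(Î^k)`. -/
def tensorEquiv (k : ℕ) :
    InjectiveTensorPower DSpace k ≃ₗᵢ[ℝ] C(Fin k → SplitInterval, ℝ) := by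
  let L : InjectiveTensorPower DSpace k →ₗᵢ[ℝ] C(Fin k → SplitInterval, ℝ) :=
    { toFun := fun u => ⟨_, continuous_evalAt_form u.2⟩
      map_add' := fun _ _ => rfl
      map_smul' := fun _ _ => rfl
      norm_map' := fun u => by
        refine le_antisymm ((ContinuousMap.norm_le _ (norm_nonneg _)).2
          fun τ => norm_evalAt_form_le u.1 τ) ?_
        -- the reverse inequality holds on the span of the elementary tensors, and extends by density
        refine le_of_forall_pos_le_add fun ε hε => ?_
        obtain ⟨v, hv, hvu⟩ := exists_span_near u.2 (half_pos hε)
        set C := ‖(⟨_, continuous_evalAt_form u.2⟩ : C(Fin k → SplitInterval, ℝ))‖ with hCdef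
        have hv' : ‖v‖ ≤ C + ε / 2 := by
          refine norm_le_of_evalAt hv (by positivity) fun τ => ?_
          have h1 : ‖u.1 fun i => evalAt (τ i)‖ ≤ C :=
            ContinuousMap.norm_coe_le_norm
              (⟨_, continuous_evalAt_form u.2⟩ : C(Fin k → SplitInterval, ℝ)) τ
          have h2 := norm_evalAt_form_le (u.1 - v) τ
          rw [sub_apply] at h2
          have h3 := norm_sub_norm_le (v fun i => evalAt (τ i)) (u.1 fun i => evalAt (τ i))
          rw [norm_sub_rev] at h3
          linarith
        have h4 : ‖u.1‖ ≤ ‖v‖ + ‖u.1 - v‖ := by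
          simpa using norm_add_le v (u.1 - v)
        change ‖u.1‖ ≤ C + ε
        linarith }
  refine LinearIsometryEquiv.ofSurjective L ?_
  have hclosed : IsClosed (LinearMap.range L.toLinearMap : Set C(Fin k → SplitInterval, ℝ)) := by
    rw [LinearMap.coe_range]
    exact L.isometry.isClosedEmbedding.isClosed_range
  have htop := submodule_eq_top (LinearMap.range L.toLinearMap) hclosed fun f => by
    refine ⟨elementaryTensor fun i => cadlagEquiv (f i), ?_⟩
    ext τ
    change elementaryForm DSpace _ _ = _
    simp [extend]
  exact LinearMap.range_eq_top.1 htop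

theorem tensorEquiv_elementaryTensor (x : Fin k → DSpace) :
    tensorEquiv k (elementaryTensor x) = prodMap fun i => extend (x i) := by
  ext τ
  change elementaryForm DSpace _ _ = _
  simp

theorem tensorEquiv_tensorPow (x : DSpace) :
    tensorEquiv k (tensorPow k x) = prodMap fun _ => extend x :=
  tensorEquiv_elementaryTensor _

theorem norm_prodMap_const (f : C(SplitInterval, ℝ)) :
    ‖prodMap fun _ : Fin k => f‖ = ‖f‖ ^ k := by
  refine le_antisymm ((ContinuousMap.norm_le _ (by positivity)).2 fun τ => ?_) ?_
  · rw [prodMap_apply, norm_prod]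
    exact (Finset.prod_le_prod (fun _ _ => norm_nonneg _)
      fun i _ => f.norm_coe_le_norm (τ i)).trans (by simp)
  · obtain ⟨τ, -, hτ⟩ := isCompact_univ.exists_isMaxOn (univ_nonempty (α := SplitInterval))
      (map_continuous f).norm.continuousOn
    have h1 : ‖f‖ = ‖f τ‖ := le_antisymm
      ((ContinuousMap.norm_le _ (norm_nonneg _)).2 fun x => hτ (mem_univ x)) (f.norm_coe_le_norm τ)
    have h2 := (prodMap fun _ : Fin k => f).norm_coe_le_norm fun _ => τ
    simpa [h1] using h2

/-! ### Rounding up to a grid -/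

section

variable {k : ℕ}

/-- The least of the first `n` grid points `s₀, …, s_{n-1}` that is at least `τ`; if there is none,
the largest point `1` of the split interval. -/
def gridRound (s : ℕ → SplitInterval) (n : ℕ) (τ : SplitInterval) : SplitInterval :=
  (Finset.range n).inf fun j => if τ ≤ s j then s j else ⊤

theorem le_gridRound (s : ℕ → SplitInterval) (n : ℕ) (τ : SplitInterval) :
    τ ≤ gridRound s n τ := by
  refine Finset.le_inf fun j _ => ?_
  split_ifs with h
  exacts [h, le_top]

theorem gridRound_le {s : ℕ → SplitInterval} {n j : ℕ} (hj : j < n) {τ : SplitInterval}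
    (h : τ ≤ s j) : gridRound s n τ ≤ s j := by
  refine (Finset.inf_le (Finset.mem_range.2 hj)).trans ?_
  rw [if_pos h]

theorem finite_range_gridRound (s : ℕ → SplitInterval) (n : ℕ) :
    (range (gridRound s n)).Finite := by
  refine (((Finset.range n).image s).finite_toSet.insert (⊤ : SplitInterval)).subset ?_
  rintro _ ⟨τ, rfl⟩
  refine Finset.inf_induction
    (p := (· ∈ insert (⊤ : SplitInterval) (((Finset.range n).image s : Finset _) : Set _)))
    (mem_insert _ _) (fun a ha b hb => ?_) fun j hj => ?_
  · rcases min_choice a b with h | h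
    · exact (congrArg (· ∈ _) h).mpr ha
    · exact (congrArg (· ∈ _) h).mpr hb
  · split_ifs
    · exact mem_insert_of_mem _ (Finset.mem_coe.2 (Finset.mem_image_of_mem _ hj))
    · exact mem_insert _ _

/-- A grid: a sequence of points of the split interval whose projection to `[0,1]` is dense, such
that the intervals with these points as right end points are open. Thus the grid points are of the
form `t-`, apart from the largest point `1`. -/
structure IsGrid (s : ℕ → SplitInterval) : Prop where
  isOpen_Iic : ∀ j, IsOpen (Iic (s j))
  exists_between : ∀ a b : I, a < b → ∃ j, a < val (s j) ∧ val (s j) < b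

/-- There are grids through any countable set of points of the form `t-`. -/
theorem exists_isGrid {N : Set I} (hN : N.Countable) :
    ∃ s, IsGrid s ∧ ∀ a ∈ N, ∀ ha : 0 < a, ∃ j, s j = minus a ha := by
  obtain ⟨Q, hQ, hQd⟩ := TopologicalSpace.exists_countable_dense I
  obtain ⟨q, hq⟩ := ((hN.union hQ).insert 1).exists_eq_range (insert_nonempty _ _)
  refine ⟨fun j => if h : 0 < q j then minus (q j) h else ⊤, ⟨fun j => ?_, fun a b hab => ?_⟩,
    fun a ha ha0 => ?_⟩
  · split_ifs with h
    · exact (isClopen_Iic_minus _ h).2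
    · rw [Iic_top]; exact isOpen_univ
  · obtain ⟨c, hc, h1, h2⟩ := hQd.exists_between hab
    obtain ⟨j, hj⟩ : c ∈ range q := hq ▸ mem_insert_of_mem _ (Or.inr hc)
    have h0 : 0 < q j := by
      rw [hj]; exact lt_of_le_of_lt unitInterval.nonneg' h1
    refine ⟨j, ?_⟩
    rw [dif_pos h0, val_minus, hj]
    exact ⟨h1, h2⟩
  · obtain ⟨j, hj⟩ : a ∈ range q := hq ▸ mem_insert_of_mem _ (Or.inl ha)
    subst hj
    exact ⟨j, dif_pos ha0⟩

namespace IsGrid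

variable {s : ℕ → SplitInterval}

theorem continuous_gridRound (hs : IsGrid s) (n : ℕ) : Continuous (gridRound s n) := by
  refine Continuous.finset_inf_apply fun j _ => ?_
  refine continuous_const.if (fun τ hτ => ?_) continuous_const
  have h : IsClopen {τ | τ ≤ s j} := ⟨isClosed_Iic, hs.isOpen_Iic j⟩
  rw [h.frontier_eq] at hτ
  exact hτ.elim

theorem tendsto_val_gridRound (hs : IsGrid s) (τ : SplitInterval) :
    Tendsto (fun p : ℕ × SplitInterval => val (gridRound s p.1 p.2)) (atTop ×ˢ 𝓝 τ)
      (𝓝 (val τ)) := by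
  have hval : Tendsto (fun p : ℕ × SplitInterval => val p.2) (atTop ×ˢ 𝓝 τ) (𝓝 (val τ)) :=
    (continuous_val.tendsto τ).comp tendsto_snd
  refine tendsto_order.2 ⟨fun c hc => ?_, fun c hc => ?_⟩
  · filter_upwards [hval.eventually (lt_mem_nhds hc)] with p hp
    exact hp.trans_le (val_mono (le_gridRound s _ _))
  · obtain ⟨j, h1, h2⟩ := hs.exists_between _ _ hc
    filter_upwards [hval.eventually (gt_mem_nhds h1),
      tendsto_fst.eventually (eventually_gt_atTop j)] with p hp hj
    exact (val_mono (gridRound_le hj (lt_of_val_lt hp).le)).trans_lt h2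

theorem tendsto_gridRound_ordinary (hs : IsGrid s) (t : I) :
    Tendsto (fun p : ℕ × SplitInterval => gridRound s p.1 p.2) (atTop ×ˢ 𝓝 (ordinary t))
      (𝓝 (ordinary t)) := by
  conv_rhs => rw [nhds_ordinary]
  refine tendsto_inf.2 ⟨tendsto_comap_iff.2 (hs.tendsto_val_gridRound _), tendsto_principal.2 ?_⟩
  filter_upwards [tendsto_snd.eventually ((isClopen_Ici_ordinary t).2.mem_nhds self_mem_Ici)]
    with p hp
  exact le_trans hp (le_gridRound s _ _)

theorem tendsto_gridRound_minus (hs : IsGrid s) {t : I} {ht : 0 < t} (h : ∃ j, s j = minus t ht) :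
    Tendsto (fun p : ℕ × SplitInterval => gridRound s p.1 p.2) (atTop ×ˢ 𝓝 (minus t ht))
      (𝓝 (minus t ht)) := by
  obtain ⟨j, hj⟩ := h
  conv_rhs => rw [nhds_minus]
  refine tendsto_inf.2 ⟨tendsto_comap_iff.2 (hs.tendsto_val_gridRound _), tendsto_principal.2 ?_⟩
  filter_upwards [tendsto_snd.eventually ((isClopen_Iic_minus t ht).2.mem_nhds self_mem_Iic),
    tendsto_fst.eventually (eventually_gt_atTop j)] with p hp hjp
  rw [← hj]
  exact gridRound_le hjp (hj ▸ hp)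

/-- Rounding up to a grid, as a continuous map of the split interval to itself. -/
def round (hs : IsGrid s) (n : ℕ) : C(SplitInterval, SplitInterval) :=
  ⟨gridRound s n, hs.continuous_gridRound n⟩

/-- Rounding up all coordinates to a grid. -/
def roundPow (hs : IsGrid s) (k n : ℕ) : C(Fin k → SplitInterval, Fin k → SplitInterval) :=
  ⟨fun τ i => gridRound s n (τ i), continuous_pi fun i =>
    (hs.continuous_gridRound n).comp (continuous_apply i)⟩

@[simp] theorem round_apply (hs : IsGrid s) (n : ℕ) (τ : SplitInterval) : 
    hs.round n τ = gridRound s n τ := rfl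

@[simp] theorem roundPow_apply (hs : IsGrid s) (n : ℕ) (τ : Fin k → SplitInterval) (i : Fin k) :
    hs.roundPow k n τ i = gridRound s n (τ i) := rfl

theorem finite_range_roundPow (hs : IsGrid s) (n : ℕ) : (range (hs.roundPow k n)).Finite := by
  refine (Finite.pi fun _ : Fin k => finite_range_gridRound s n).subset ?_
  rintro _ ⟨τ, rfl⟩ i -
  exact ⟨τ i, rfl⟩

/-- If the grid contains `t-` for every jump point `t` of a càdlàg function, then the corresponding
step functions converge uniformly to the function. -/
theorem tendsto_comp_round (hs : IsGrid s) (f : C(SplitInterval, ℝ))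
    (h : ∀ t ht, f (minus t ht) ≠ f (ordinary t) → ∃ j, s j = minus t ht) :
    Tendsto (fun n => f.comp (hs.round n)) atTop (𝓝 f) := by
  rw [ContinuousMap.tendsto_iff_tendstoUniformly,
    ← tendstoLocallyUniformly_iff_tendstoUniformly_of_compactSpace,
    tendstoLocallyUniformly_iff_forall_tendsto]
  intro τ
  have hlim : Tendsto (fun p : ℕ × SplitInterval => f (gridRound s p.1 p.2)) (atTop ×ˢ 𝓝 τ)
      (𝓝 (f τ)) := by
    rcases cases τ with ⟨t, rfl⟩ | ⟨t, ht, rfl⟩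
    · exact ((map_continuous f).tendsto _).comp (hs.tendsto_gridRound_ordinary t)
    · by_cases hj : f (minus t ht) = f (ordinary t)
      · have h1 : Tendsto (fun p : ℕ × SplitInterval => gridRound s p.1 p.2)
            (atTop ×ˢ 𝓝 (minus t ht)) (𝓝 (minus t ht) ⊔ 𝓝 (ordinary t)) :=
          Tendsto.mono_right (tendsto_comap_iff (g := val).2
            (hs.tendsto_val_gridRound (minus t ht))) (comap_val_le t ht)
        refine Tendsto.comp (tendsto_sup.2 ⟨(map_continuous f).tendsto _, ?_⟩) h1
        rw [hj]
        exact (map_continuous f).tendsto _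
      · exact ((map_continuous f).tendsto _).comp (hs.tendsto_gridRound_minus (h t ht hj))
  have hlim' : Tendsto (fun p : ℕ × SplitInterval => f p.2) (atTop ×ˢ 𝓝 τ) (𝓝 (f τ)) :=
    ((map_continuous f).tendsto τ).comp tendsto_snd
  exact (hlim'.prodMk_nhds hlim).mono_right (nhds_le_uniformity (f τ))

end IsGrid

/-! ### Functionals on `C(Î^k)` -/

section Localize

variable {A : Type*} [NormedCommRing A] [NormedAlgebra ℝ A]

/-- The functional `h ↦ ψ(g h)`, as a function of `g`. Its norm plays the role of the integral of
`|g|` with respect to the variation of `ψ`. -/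
def localize (ψ : StrongDual ℝ A) : A →L[ℝ] StrongDual ℝ A :=
  (ContinuousLinearMap.compL ℝ A A ℝ ψ).comp (ContinuousLinearMap.mul ℝ A)

@[simp] theorem localize_apply (ψ : StrongDual ℝ A) (g h : A) : localize ψ g h = ψ (g * h) := rfl

theorem norm_localize_mul_le (ψ : StrongDual ℝ A) (g h : A) :
    ‖localize ψ (g * h)‖ ≤ ‖localize ψ g‖ * ‖h‖ := by
  refine ContinuousLinearMap.opNorm_le_bound _ (by positivity) fun x => ?_
  rw [localize_apply, mul_assoc, ← localize_apply, mul_assoc]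
  exact ((localize ψ g).le_opNorm _).trans (by gcongr; exact norm_mul_le _ _)

end Localize

theorem norm_comp_le {K L : Type*} [TopologicalSpace K] [CompactSpace K] [TopologicalSpace L]
    [CompactSpace L] (G : C(L, ℝ)) (r : C(K, L)) : ‖G.comp r‖ ≤ ‖G‖ :=
  (ContinuousMap.norm_le _ (norm_nonneg _)).2 fun _ => G.norm_coe_le_norm _

theorem step_sub_step {a b : I} (hab : a < b) (τ : SplitInterval) :
    step a τ - step b τ = if ordinary a ≤ τ ∧ τ < ordinary b then 1 else 0 := by
  by_cases h1 : ordinary a ≤ τ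
  · by_cases h2 : τ < ordinary b
    · rw [step_of_le h1, step_of_lt h2, if_pos ⟨h1, h2⟩, sub_zero]
    · rw [step_of_le h1, step_of_le (not_lt.1 h2), if_neg fun h => h2 h.2, sub_self]
  · have h2 : τ < ordinary b :=
      (not_le.1 h1).trans_le (le_ordinary_iff.2 hab.le)
    rw [step_of_lt (not_le.1 h1), step_of_lt h2, if_neg fun h => h1 h.1, sub_self]

/-- The points `a` such that the variation of `ψ` charges the hyperplane `τᵢ = a-` with mass at
least `ε`. -/
def heavy (ψ : StrongDual ℝ C(Fin k → SplitInterval, ℝ)) (i : Fin k) (ε : ℝ) : Set I :=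
  {a | 0 < a ∧ ∀ b < a, ε ≤ ‖localize ψ (stepAt i b - stepAt i a)‖}

/-- If `p` hyperplanes have mass at least `ε`, then `p ε ≤ ‖ψ‖`, because `ψ` can be tested with a
function that is supported in disjoint neighbourhoods of the hyperplanes. -/
theorem finite_heavy (ψ : StrongDual ℝ C(Fin k → SplitInterval, ℝ)) (i : Fin k) {ε : ℝ}
    (hε : 0 < ε) : (heavy ψ i ε).Finite := by
  have key : ∀ F : Finset I, ↑F ⊆ heavy ψ i ε → F.card * (ε / 2) ≤ ‖ψ‖ := by
    intro F hF
    -- `b a` is the predecessor of `a` in `F`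
    let b : I → I := fun a => (F.filter (· < a)).sup id
    have hb : ∀ a ∈ F, b a < a := fun a ha => by
      refine (Finset.sup_lt_iff (show (⊥ : I) < a from (hF ha).1)).2 fun c hc => ?_
      exact (Finset.mem_filter.1 hc).2
    have hb' : ∀ a ∈ F, ∀ c ∈ F, c < a → c ≤ b a := fun a _ c hc hca =>
      Finset.le_sup (f := id) (Finset.mem_filter.2 ⟨hc, hca⟩)
    have hex : ∀ a : I, ∃ G : C(Fin k → SplitInterval, ℝ), ‖G‖ ≤ 1 ∧
        (a ∈ F → ε / 2 ≤ ψ ((stepAt i (b a) - stepAt i a) * G)) := by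
      intro a
      by_cases ha : a ∈ F
      · have h1 : ε / 2 < ‖localize ψ (stepAt i (b a) - stepAt i a)‖ :=
          (half_lt_self hε).trans_le ((hF ha).2 _ (hb a ha))
        obtain ⟨G, hG, hG'⟩ := ContinuousLinearMap.exists_lt_apply_of_lt_opNorm _ h1
        rw [localize_apply, Real.norm_eq_abs] at hG'
        rcases abs_cases (ψ ((stepAt i (b a) - stepAt i a) * G)) with h | h
        · exact ⟨G, hG.le, fun _ => by linarith⟩
        · refine ⟨-G, by rw [norm_neg]; exact hG.le, fun _ => ?_⟩
          rw [mul_neg, map_neg]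
          linarith
      · exact ⟨0, by simp, fun h => absurd h ha⟩
    choose G hG hG' using hex
    have hnorm : ‖∑ a ∈ F, (stepAt i (b a) - stepAt i a) * G a‖ ≤ 1 := by
      refine (ContinuousMap.norm_le _ zero_le_one).2 fun τ => ?_
      rw [ContinuousMap.sum_apply]
      by_cases hτ : ∃ a ∈ F, ordinary (b a) ≤ τ i ∧ τ i < ordinary a
      · obtain ⟨a, ha, h1, h2⟩ := hτ
        rw [Finset.sum_eq_single a]
        · rw [ContinuousMap.mul_apply, ContinuousMap.sub_apply, stepAt_apply, stepAt_apply,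
            step_sub_step (hb a ha), if_pos ⟨h1, h2⟩, one_mul]
          exact ((G a).norm_coe_le_norm τ).trans (hG a)
        · intro c hc hca
          rw [ContinuousMap.mul_apply, ContinuousMap.sub_apply, stepAt_apply, stepAt_apply,
            step_sub_step (hb c hc), if_neg, zero_mul]
          rintro ⟨h3, h4⟩
          rcases lt_or_gt_of_ne hca with h | h
          · exact absurd (h4.trans_le ((le_ordinary_iff.2 (hb' a ha c hc h)).trans h1))
              (lt_irrefl _)
          · exact absurd (h2.trans_le ((le_ordinary_iff.2 (hb' c hc a ha h)).trans h3))
              (lt_irrefl _)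
        · exact fun h => absurd ha h
      · rw [Finset.sum_eq_zero]
        · simp
        · intro c hc
          rw [ContinuousMap.mul_apply, ContinuousMap.sub_apply, stepAt_apply, stepAt_apply,
            step_sub_step (hb c hc), if_neg fun h => hτ ⟨c, hc, h⟩, zero_mul]
    calc F.card * (ε / 2) = ∑ a ∈ F, ε / 2 := by rw [Finset.sum_const, nsmul_eq_mul]
      _ ≤ ∑ a ∈ F, ψ ((stepAt i (b a) - stepAt i a) * G a) :=
        Finset.sum_le_sum fun a ha => hG' a ha
      _ = ψ (∑ a ∈ F, (stepAt i (b a) - stepAt i a) * G a) := (map_sum _ _ _).symm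
      _ ≤ ‖ψ (∑ a ∈ F, (stepAt i (b a) - stepAt i a) * G a)‖ := Real.le_norm_self _
      _ ≤ ‖ψ‖ * 1 := (ψ.le_opNorm _).trans (by gcongr)
      _ = ‖ψ‖ := mul_one _
  by_contra hinf
  obtain ⟨n, hn⟩ := exists_nat_gt (‖ψ‖ / (ε / 2))
  obtain ⟨F, hF, hFn⟩ := Set.Infinite.exists_subset_card_eq hinf n
  have := key F hF
  rw [hFn] at this
  rw [div_lt_iff₀ (half_pos hε)] at hn
  linarith

/-- A functional on `C(Î^k)` commutes in the limit with rounding up to a grid, if the grid passes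
through the countably many `t-` that correspond to hyperplanes charged by the functional. -/
theorem exists_countable_tendsto_roundPow (ψ : StrongDual ℝ C(Fin k → SplitInterval, ℝ)) :
    ∃ N : Set I, N.Countable ∧ ∀ (s : ℕ → SplitInterval) (hs : IsGrid s),
      (∀ a ∈ N, ∀ ha : 0 < a, ∃ j, s j = minus a ha) →
      ∀ G, Tendsto (fun n => ψ (G.comp (hs.roundPow k n))) atTop (𝓝 (ψ G)) := by
  refine ⟨⋃ (i : Fin k) (m : ℕ), heavy ψ i (1 / (m + 1)), countable_iUnion fun i =>
    countable_iUnion fun m => (finite_heavy ψ i Nat.one_div_pos_of_nat).countable, ?_⟩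
  intro s hs hN
  let R := hs.roundPow k
  -- the functions for which the convergence holds in total variation form a closed subalgebra
  let T : C(Fin k → SplitInterval, ℝ) → ℕ → ℝ := fun G n => ‖localize ψ (G.comp (R n) - G)‖
  have hT0 : ∀ G n, 0 ≤ T G n := fun _ _ => norm_nonneg _
  let 𝒜 : Subalgebra ℝ C(Fin k → SplitInterval, ℝ) :=
    { carrier := {G | Tendsto (T G) atTop (𝓝 0)}
      algebraMap_mem' := fun c => by
        have : T (algebraMap ℝ _ c) = fun _ => 0 := by
          funext n
          have : (algebraMap ℝ C(Fin k → SplitInterval, ℝ) c).comp (R n) -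
              algebraMap ℝ C(Fin k → SplitInterval, ℝ) c = 0 := by
            ext τ; simp
          simp only [T, this, map_zero, norm_zero]
        change Tendsto (T _) atTop (𝓝 0)
        rw [this]
        exact tendsto_const_nhds
      add_mem' := fun {G H} hG hH => by
        refine squeeze_zero (hT0 _) (fun n => ?_) (by simpa using hG.add hH)
        have : (G + H).comp (R n) - (G + H) = (G.comp (R n) - G) + (H.comp (R n) - H) := by
          ext τ; simp; ring
        simp only [T, this, map_add]
        exact norm_add_le _ _
      mul_mem' := fun {G H} hG hH => by
        refine squeeze_zero (hT0 _) (fun n => ?_)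
          (by simpa using (hH.mul_const ‖G‖).add (hG.mul_const ‖H‖))
        have : (G * H).comp (R n) - (G * H) =
            (H.comp (R n) - H) * G.comp (R n) + (G.comp (R n) - G) * H := by
          ext τ; simp; ring
        simp only [T, this, map_add]
        refine (norm_add_le _ _).trans (add_le_add ?_ (norm_localize_mul_le _ _ _))
        exact (norm_localize_mul_le _ _ _).trans
          (mul_le_mul_of_nonneg_left (norm_comp_le _ _) (norm_nonneg _)) }
  have hclosed : IsClosed (𝒜 : Set C(Fin k → SplitInterval, ℝ)) := by
    refine isClosed_of_closure_subset fun G hG => ?_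
    change Tendsto (T G) atTop (𝓝 0)
    rw [Metric.tendsto_atTop]
    intro ε hε
    have hpos : 0 < ‖localize ψ‖ * 2 + 1 := by positivity
    obtain ⟨H, hH, hGH⟩ := Metric.mem_closure_iff.1 hG (ε / 2 / (‖localize ψ‖ * 2 + 1))
      (by positivity)
    obtain ⟨n₀, hn₀⟩ := Metric.tendsto_atTop.1 (show Tendsto (T H) atTop (𝓝 0) from hH) (ε / 2)
      (half_pos hε)
    refine ⟨n₀, fun n hn => ?_⟩
    have h1 := hn₀ n hn
    rw [Real.dist_0_eq_abs, abs_of_nonneg (hT0 _ _)] at h1 ⊢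
    rw [dist_eq_norm, lt_div_iff₀ hpos] at hGH
    have h2 : G.comp (R n) - G = (H.comp (R n) - H) + ((G - H).comp (R n) - (G - H)) := by
      ext τ; simp; ring
    have h3 : T G n ≤ T H n + ‖localize ψ‖ * (2 * ‖G - H‖) := by
      simp only [T, h2, map_add]
      refine (norm_add_le _ _).trans (add_le_add le_rfl ?_)
      refine ((localize ψ).le_opNorm _).trans (mul_le_mul_of_nonneg_left ?_ (norm_nonneg _))
      refine (norm_sub_le _ _).trans ?_
      have := norm_comp_le (G - H) (R n)
      linarith
    nlinarith [norm_nonneg (G - H)]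
  have htop : 𝒜 = ⊤ := by
    refine subalgebra_eq_top 𝒜 hclosed fun i a => ?_
    change Tendsto (T (stepAt i a)) atTop (𝓝 0)
    rcases eq_or_lt_of_le (unitInterval.nonneg' (t := a)) with rfl | ha
    · have : ∀ n, T (stepAt i 0) n = 0 := fun n => by
        have : (stepAt i 0).comp (R n) - stepAt i 0 = 0 := by
          ext τ
          simp [step_of_le (ordinary_zero_le _)]
        simp only [T, this, map_zero, norm_zero]
      exact tendsto_const_nhds.congr fun n => (this n).symm
    · by_cases haN : ∃ j, s j = minus a ha
      · obtain ⟨j, hj⟩ := haN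
        refine tendsto_const_nhds.congr' ?_
        filter_upwards [eventually_gt_atTop j] with n hn
        have : (stepAt i a).comp (R n) - stepAt i a = 0 := by
          ext τ
          simp only [ContinuousMap.sub_apply, ContinuousMap.comp_apply, stepAt_apply,
            ContinuousMap.zero_apply, R, hs.roundPow_apply]
          rcases le_or_gt (ordinary a) (τ i) with h | h
          · rw [step_of_le h, step_of_le (h.trans (le_gridRound _ _ _)), sub_self]
          · have h' : gridRound s n (τ i) ≤ minus a ha :=
              hj ▸ gridRound_le hn (hj ▸ lt_ordinary_iff.1 h)
            rw [step_of_lt h, step_of_lt (lt_ordinary_iff.2 h'), sub_self]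
        simp only [T, this, map_zero, norm_zero]
      · have hlight : ∀ ε > 0, ∃ b < a, ‖localize ψ (stepAt i b - stepAt i a)‖ < ε := by
          intro ε hε
          obtain ⟨m, hm⟩ := exists_nat_one_div_lt hε
          -- otherwise `a` is one of the points of `N`, which the grid contains
          by_contra! hcon
          exact haN (hN a (mem_iUnion₂.2 ⟨i, m, ha, fun b hb => hm.le.trans (hcon b hb)⟩) ha)
        rw [Metric.tendsto_atTop]
        intro ε hε
        obtain ⟨b, hb, hbε⟩ := hlight ε hε
        obtain ⟨j, hj1, hj2⟩ := hs.exists_between b a hb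
        refine ⟨j + 1, fun n hn => ?_⟩
        rw [Real.dist_0_eq_abs, abs_of_nonneg (hT0 _ _)]
        have : (stepAt i a).comp (R n) - stepAt i a =
            (stepAt i b - stepAt i a) * (stepAt i a).comp (R n) := by
          ext τ
          simp only [ContinuousMap.sub_apply, ContinuousMap.comp_apply, stepAt_apply,
            ContinuousMap.mul_apply, R, hs.roundPow_apply, step_sub_step hb]
          rcases le_or_gt (ordinary a) (τ i) with h | h
          · rw [step_of_le h, step_of_le (h.trans (le_gridRound _ _ _)),
              if_neg fun h' => (not_le.2 h'.2) h]
            simp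
          · rcases le_or_gt (ordinary b) (τ i) with h' | h'
            · rw [step_of_lt h, if_pos ⟨h', h⟩]
              simp
            · have h1 : τ i ≤ s j :=
                h'.le.trans (ordinary_lt_iff.2 hj1).le
              have h2 : gridRound s n (τ i) < ordinary a :=
                (gridRound_le hn h1).trans_lt (lt_of_val_lt hj2)
              rw [step_of_lt h, step_of_lt h2]
              simp
        have hle : ‖(stepAt i a).comp (R n)‖ ≤ 1 := by
          refine (ContinuousMap.norm_le _ zero_le_one).2 fun τ => ?_
          simp only [ContinuousMap.comp_apply, stepAt_apply]
          rcases le_or_gt (ordinary a) (R n τ i) with h | h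
          · rw [step_of_le h]; simp
          · rw [step_of_lt h]; simp
        simp only [T, this]
        calc _ ≤ ‖localize ψ (stepAt i b - stepAt i a)‖ * ‖(stepAt i a).comp (R n)‖ :=
              norm_localize_mul_le _ _ _
          _ ≤ ‖localize ψ (stepAt i b - stepAt i a)‖ * 1 :=
              mul_le_mul_of_nonneg_left hle (norm_nonneg _)
          _ < ε := by rwa [mul_one]
  intro G
  have hG : Tendsto (T G) atTop (𝓝 0) := by
    have : G ∈ 𝒜 := htop ▸ Algebra.mem_top
    exact this
  have hG' : Tendsto (fun n => T G n * ‖(1 : C(Fin k → SplitInterval, ℝ))‖) atTop (𝓝 0) := by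
    simpa using hG.mul_const ‖(1 : C(Fin k → SplitInterval, ℝ))‖
  rw [tendsto_iff_norm_sub_tendsto_zero]
  refine squeeze_zero (fun _ => norm_nonneg _) (fun n => ?_) hG'
  have := (localize ψ (G.comp (R n) - G)).le_opNorm 1
  rwa [localize_apply, mul_one, map_sub] at this

/-- A function of a rounded argument is a finite linear combination of indicator functions that do
not depend on the function. -/
theorem exists_comp_eq_sum {K : Type*} [TopologicalSpace K] [T1Space K] (r : C(K, K))
    (hr : (range r).Finite) :
    ∃ e : K → C(K, ℝ), (∀ G : C(K, ℝ), G.comp r = ∑ x ∈ hr.toFinset, G x • e x) ∧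
      ∀ (c : K → ℝ) y, (∑ x ∈ hr.toFinset, c x • e x) y = c (r y) := by
  classical
  have hclopen : ∀ x, IsClopen (r ⁻¹' {x}) := fun x => by
    refine ⟨isClosed_singleton.preimage r.continuous, ?_⟩
    have : r ⁻¹' {x} = (r ⁻¹' (range r \ {x}))ᶜ := by
      ext y; simp
    rw [this, isOpen_compl_iff]
    exact hr.sdiff.isClosed.preimage r.continuous
  let e : K → C(K, ℝ) := fun x => clopenIndicator (hclopen x)
  have he : ∀ x y, e x y = if r y = x then 1 else 0 := fun x y => by
    simp [e, clopenIndicator, indicator_apply]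
  have hsum : ∀ (c : K → ℝ) y, (∑ x ∈ hr.toFinset, c x • e x) y = c (r y) := fun c y => by
    rw [ContinuousMap.sum_apply, Finset.sum_eq_single (r y)]
    · simp [he]
    · intro x _ hx
      simp [he, hx.symm]
    · intro h
      exact absurd (hr.mem_toFinset.2 ⟨y, rfl⟩) h
  exact ⟨e, fun G => by ext y; rw [hsum G y]; rfl, hsum⟩

/-- On the functions of a rounded argument, a functional is a finite linear combination of point
evaluations, with coefficients whose absolute values sum to at most the norm of the functional. -/
theorem exists_finset_sum_of_finite_range {K : Type*} [TopologicalSpace K] [CompactSpace K]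
    [T1Space K] (ψ : StrongDual ℝ C(K, ℝ)) (r : C(K, K)) (hr : (range r).Finite) :
    ∃ (S : Finset K) (c : K → ℝ), (∀ G : C(K, ℝ), ψ (G.comp r) = ∑ x ∈ S, c x * G x) ∧
      ∑ x ∈ S, |c x| ≤ ‖ψ‖ := by
  obtain ⟨e, he, hsum⟩ := exists_comp_eq_sum r hr
  refine ⟨hr.toFinset, fun x => ψ (e x), fun G => ?_, ?_⟩
  · rw [he, map_sum]
    exact Finset.sum_congr rfl fun x _ => by rw [map_smul, smul_eq_mul, mul_comm]
  · let c : K → ℝ := fun x => SignType.sign (ψ (e x))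
    have h1 : ∑ x ∈ hr.toFinset, |ψ (e x)| = ψ (∑ x ∈ hr.toFinset, c x • e x) := by
      rw [map_sum]
      exact Finset.sum_congr rfl fun x _ => by
        rw [map_smul, smul_eq_mul, sign_mul_self]
    have h2 : ‖∑ x ∈ hr.toFinset, c x • e x‖ ≤ 1 := by
      refine (ContinuousMap.norm_le _ zero_le_one).2 fun y => ?_
      rw [hsum]
      rcases lt_trichotomy (ψ (e (r y))) 0 with h | h | h <;> simp [c, h]
    rw [h1]
    calc _ ≤ ‖ψ (∑ x ∈ hr.toFinset, c x • e x)‖ := Real.le_norm_self _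
      _ ≤ ‖ψ‖ * 1 := (ψ.le_opNorm _).trans (by gcongr)
      _ = ‖ψ‖ := mul_one _

end

/-! ### Moments of random functionals -/

section

variable {k : ℕ}

theorem exists_seq_ordinary (τ : SplitInterval) :
    ∃ t : ℕ → I, Tendsto (fun n => ordinary (t n)) atTop (𝓝 τ) := by
  obtain ⟨x, hx, hxτ⟩ := mem_closure_iff_seq_limit.1 (denseRange_ordinary τ)
  choose t ht using hx
  exact ⟨t, by simpa [ht] using hxτ⟩

theorem prod_le_sum_pow (hk : 1 ≤ k) (a : Fin k → ℝ≥0∞) : ∏ i, a i ≤ ∑ i, a i ^ k := by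
  obtain ⟨j, -, hj⟩ := Finset.exists_max_image (Finset.univ : Finset (Fin k)) a
    ⟨⟨0, hk⟩, Finset.mem_univ _⟩
  calc ∏ i, a i ≤ ∏ _i : Fin k, a j := Finset.prod_le_prod' fun i hi => hj i hi
    _ = a j ^ k := by simp
    _ ≤ ∑ i, a i ^ k :=
      Finset.single_le_sum (f := fun i => a i ^ k) (fun _ _ => zero_le) (Finset.mem_univ j)

theorem enorm_prod {ι : Type*} (S : Finset ι) (a : ι → ℝ) :
    ‖∏ i ∈ S, a i‖ₑ = ∏ i ∈ S, ‖a i‖ₑ := by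
  classical
  induction S using Finset.induction_on with
  | empty => simp
  | insert j S hj ih => rw [Finset.prod_insert hj, Finset.prod_insert hj, enorm_mul, ih]

variable {Ω : Type*} [MeasurableSpace Ω] {X : Ω → DSpace}

theorem measurable_extend (hX : ∀ t : I, Measurable fun ω => X ω t) (τ : SplitInterval) :
    Measurable fun ω => extend (X ω) τ := by
  obtain ⟨t, ht⟩ := exists_seq_ordinary τ
  refine measurable_of_tendsto_metrizable (f := fun n ω => X ω (t n)) (fun n => hX _) ?_
  refine tendsto_pi_nhds.2 fun ω => ?_
  simpa [Function.comp_def] using ((map_continuous (extend (X ω))).tendsto τ).comp ht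

theorem lintegral_extend_le (hX : ∀ t : I, Measurable fun ω => X ω t) (μ : Measure Ω) (k : ℕ)
    (τ : SplitInterval) :
    ∫⁻ ω, ‖extend (X ω) τ‖ₑ ^ k ∂μ ≤ ⨆ t : I, ∫⁻ ω, ‖X ω t‖ₑ ^ k ∂μ := by
  obtain ⟨t, ht⟩ := exists_seq_ordinary τ
  have hlim : ∀ ω, Tendsto (fun n => ‖X ω (t n)‖ₑ ^ k) atTop (𝓝 (‖extend (X ω) τ‖ₑ ^ k)) :=
    fun ω => by
      simpa using ENNReal.Tendsto.pow (((map_continuous (extend (X ω))).tendsto τ).comp ht).enorm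
  calc ∫⁻ ω, ‖extend (X ω) τ‖ₑ ^ k ∂μ
      = ∫⁻ ω, liminf (fun n => ‖X ω (t n)‖ₑ ^ k) atTop ∂μ := by
        simp_rw [(hlim _).liminf_eq]
    _ ≤ liminf (fun n => ∫⁻ ω, ‖X ω (t n)‖ₑ ^ k ∂μ) atTop :=
        lintegral_liminf_le fun n => (hX _).enorm.pow_const k
    _ ≤ ⨆ t : I, ∫⁻ ω, ‖X ω t‖ₑ ^ k ∂μ := by
        refine liminf_le_of_le (by isBoundedDefault) fun b hb => ?_
        obtain ⟨n, hn⟩ := hb.exists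
        exact hn.trans (le_iSup (fun t => ∫⁻ ω, ‖X ω t‖ₑ ^ k ∂μ) (t n))

theorem lintegral_prod_extend_le (hX : ∀ t : I, Measurable fun ω => X ω t) (μ : Measure Ω)
    (hk : 1 ≤ k) (τ : Fin k → SplitInterval) :
    ∫⁻ ω, ‖∏ i, extend (X ω) (τ i)‖ₑ ∂μ ≤ k * ⨆ t : I, ∫⁻ ω, ‖X ω t‖ₑ ^ k ∂μ := by
  calc ∫⁻ ω, ‖∏ i, extend (X ω) (τ i)‖ₑ ∂μ
      ≤ ∫⁻ ω, ∑ i, ‖extend (X ω) (τ i)‖ₑ ^ k ∂μ := lintegral_mono fun ω => by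
        rw [enorm_prod]; exact prod_le_sum_pow hk _
    _ = ∑ i, ∫⁻ ω, ‖extend (X ω) (τ i)‖ₑ ^ k ∂μ :=
        lintegral_finsetSum _ fun i _ => (measurable_extend hX _).enorm.pow_const k
    _ ≤ ∑ _i : Fin k, ⨆ t : I, ∫⁻ ω, ‖X ω t‖ₑ ^ k ∂μ :=
        Finset.sum_le_sum fun i _ => lintegral_extend_le hX μ k _
    _ = _ := by simp

/-- A functional of the tensor power of a random càdlàg function is the limit of linear combinations
of products of its values, with uniformly absolutely summable coefficients. -/
theorem exists_approx (ψ : StrongDual ℝ C(Fin k → SplitInterval, ℝ)) :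
    ∃ (S : ℕ → Finset (Fin k → SplitInterval)) (c : ℕ → (Fin k → SplitInterval) → ℝ),
      (∀ G, Tendsto (fun n => ∑ τ ∈ S n, c n τ * G τ) atTop (𝓝 (ψ G))) ∧
      ∀ n, ∑ τ ∈ S n, |c n τ| ≤ ‖ψ‖ := by
  obtain ⟨N, hN, h⟩ := exists_countable_tendsto_roundPow ψ
  obtain ⟨s, hs, hsN⟩ := exists_isGrid hN
  choose S c hSc hc using fun n =>
    exists_finset_sum_of_finite_range ψ (hs.roundPow k n) (hs.finite_range_roundPow n)
  exact ⟨S, c, fun G => by simpa only [hSc] using h s hs hsN G, hc⟩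

theorem measurable_prodMap (hX : ∀ t : I, Measurable fun ω => X ω t)
    (τ : Fin k → SplitInterval) : Measurable fun ω => prodMap (fun _ => extend (X ω)) τ := by
  simp only [prodMap_apply]
  exact Finset.measurable_prod _ fun i _ => measurable_extend hX _

theorem measurable_functional (hX : ∀ t : I, Measurable fun ω => X ω t)
    (ψ : StrongDual ℝ C(Fin k → SplitInterval, ℝ)) :
    Measurable fun ω => ψ (prodMap fun _ => extend (X ω)) := by
  obtain ⟨S, c, hlim, -⟩ := exists_approx ψ
  refine measurable_of_tendsto_metrizable
    (f := fun n ω => ∑ τ ∈ S n, c n τ * prodMap (fun _ => extend (X ω)) τ) (fun n => ?_)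
    (tendsto_pi_nhds.2 fun ω => hlim _)
  refine Finset.measurable_sum _ fun τ _ => Measurable.const_mul ?_ _
  exact measurable_prodMap hX τ

theorem lintegral_functional_le (hX : ∀ t : I, Measurable fun ω => X ω t) (μ : Measure Ω)
    (hk : 1 ≤ k) (ψ : StrongDual ℝ C(Fin k → SplitInterval, ℝ)) :
    ∫⁻ ω, ‖ψ (prodMap fun _ => extend (X ω))‖ₑ ∂μ ≤
      ‖ψ‖ₑ * (k * ⨆ t : I, ∫⁻ ω, ‖X ω t‖ₑ ^ k ∂μ) := by
  set M := k * ⨆ t : I, ∫⁻ ω, ‖X ω t‖ₑ ^ k ∂μ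
  obtain ⟨S, c, hlim, hc⟩ := exists_approx ψ
  have hmeas : ∀ τ : Fin k → SplitInterval,
      Measurable fun ω => prodMap (fun _ => extend (X ω)) τ := measurable_prodMap hX
  have hbound : ∀ n, ∫⁻ ω, ‖∑ τ ∈ S n, c n τ * prodMap (fun _ => extend (X ω)) τ‖ₑ ∂μ ≤
      ‖ψ‖ₑ * M := fun n => by
    calc _ ≤ ∫⁻ ω, ∑ τ ∈ S n, ‖c n τ‖ₑ * ‖prodMap (fun _ => extend (X ω)) τ‖ₑ ∂μ :=
          lintegral_mono fun ω => by
            simp_rw [← enorm_mul]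
            exact enorm_sum_le _ _
      _ = ∑ τ ∈ S n, ‖c n τ‖ₑ * ∫⁻ ω, ‖prodMap (fun _ => extend (X ω)) τ‖ₑ ∂μ := by
          rw [lintegral_finsetSum _ fun τ _ => (hmeas τ).enorm.const_mul _]
          exact Finset.sum_congr rfl fun τ _ => lintegral_const_mul _ (hmeas τ).enorm
      _ ≤ ∑ τ ∈ S n, ‖c n τ‖ₑ * M := by
          gcongr with τ
          exact lintegral_prod_extend_le hX μ hk τ
      _ = (∑ τ ∈ S n, ‖c n τ‖ₑ) * M := (Finset.sum_mul _ _ _).symm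
      _ ≤ ‖ψ‖ₑ * M := by
          gcongr
          simp_rw [← ofReal_norm, ← ENNReal.ofReal_sum_of_nonneg
            (fun τ _ => norm_nonneg (c n τ))]
          exact ENNReal.ofReal_le_ofReal (hc n)
  calc ∫⁻ ω, ‖ψ (prodMap fun _ => extend (X ω))‖ₑ ∂μ
      = ∫⁻ ω, liminf (fun n => ‖∑ τ ∈ S n, c n τ * prodMap (fun _ => extend (X ω)) τ‖ₑ) atTop
          ∂μ := by
        simp_rw [(hlim _).enorm.liminf_eq]
    _ ≤ liminf (fun n => ∫⁻ ω, ‖∑ τ ∈ S n, c n τ * prodMap (fun _ => extend (X ω)) τ‖ₑ ∂μ)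
          atTop :=
        lintegral_liminf_le fun n =>
          (Finset.measurable_sum _ fun τ _ => (hmeas τ).const_mul _).enorm
    _ ≤ ‖ψ‖ₑ * M := by
        refine liminf_le_of_le (by isBoundedDefault) fun b hb => ?_
        obtain ⟨n, hn⟩ := hb.exists
        exact hn.trans (hbound n)

/-- A functional on the injective tensor power, as a functional on `C(Î^k)`. -/
def transfer (ξ : StrongDual ℝ (InjectiveTensorPower DSpace k)) :
    StrongDual ℝ C(Fin k → SplitInterval, ℝ) :=
  ξ.comp ((tensorEquiv k).symm : C(Fin k → SplitInterval, ℝ) →L[ℝ] InjectiveTensorPower DSpace k)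

theorem transfer_apply_tensorEquiv (ξ : StrongDual ℝ (InjectiveTensorPower DSpace k))
    (u : InjectiveTensorPower DSpace k) : transfer ξ (tensorEquiv k u) = ξ u := by
  simp [transfer]

theorem transfer_prodMap (ξ : StrongDual ℝ (InjectiveTensorPower DSpace k)) (x : DSpace) :
    transfer ξ (prodMap fun _ => extend x) = ξ (tensorPow k x) := by
  rw [← tensorEquiv_tensorPow, transfer_apply_tensorEquiv]

theorem norm_transfer_le (ξ : StrongDual ℝ (InjectiveTensorPower DSpace k)) :
    ‖transfer ξ‖ ≤ ‖ξ‖ := by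
  refine ContinuousLinearMap.opNorm_le_bound _ (norm_nonneg ξ) fun G => ?_
  refine (ξ.le_opNorm _).trans_eq ?_
  congr 1
  exact (tensorEquiv k).symm.norm_map G

theorem measurable_functional_tensorPow (hX : ∀ t : I, Measurable fun ω => X ω t)
    (ξ : StrongDual ℝ (InjectiveTensorPower DSpace k)) :
    Measurable fun ω => ξ (tensorPow k (X ω)) := by
  simpa only [transfer_prodMap] using measurable_functional hX (transfer ξ)

theorem lintegral_functional_tensorPow_le (hX : ∀ t : I, Measurable fun ω => X ω t)
    (μ : Measure Ω) (hk : 1 ≤ k) (ξ : StrongDual ℝ (InjectiveTensorPower DSpace k)) :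
    ∫⁻ ω, ‖ξ (tensorPow k (X ω))‖ₑ ∂μ ≤ ‖ξ‖ₑ * (k * ⨆ t : I, ∫⁻ ω, ‖X ω t‖ₑ ^ k ∂μ) := by
  have h := lintegral_functional_le hX μ hk (transfer ξ)
  simp only [transfer_prodMap] at h
  refine h.trans ?_
  gcongr
  rw [← ofReal_norm, ← ofReal_norm]
  exact ENNReal.ofReal_le_ofReal (norm_transfer_le ξ)

theorem integrable_functional_tensorPow (hX : ∀ t : I, Measurable fun ω => X ω t)
    {μ : Measure Ω} (hk : 1 ≤ k) (hM : (⨆ t : I, ∫⁻ ω, ‖X ω t‖ₑ ^ k ∂μ) < ∞)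
    (ξ : StrongDual ℝ (InjectiveTensorPower DSpace k)) :
    Integrable (fun ω => ξ (tensorPow k (X ω))) μ := by
  refine ⟨(measurable_functional_tensorPow hX ξ).aestronglyMeasurable,
    (lintegral_functional_tensorPow_le hX μ hk ξ).trans_lt ?_⟩
  exact ENNReal.mul_lt_top enorm_lt_top (ENNReal.mul_lt_top (ENNReal.natCast_lt_top k) hM)

/-! ### Existence in Dunford sense -/

theorem exists_hasDunfordMoment (hX : ∀ t : I, Measurable fun ω => X ω t)
    {P : Measure Ω} (hk : 1 ≤ k) (hM : (⨆ t : I, ∫⁻ ω, ‖X ω t‖ₑ ^ k ∂P) < ∞) :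
    ∃ z, HasDunfordMoment X P k z := by
  have hint := integrable_functional_tensorPow hX hk hM
  let z : StrongDual ℝ (InjectiveTensorPower DSpace k) →ₗ[ℝ] ℝ :=
    { toFun := fun ξ => ∫ ω, ξ (tensorPow k (X ω)) ∂P
      map_add' := fun ξ η => integral_add (hint ξ) (hint η)
      map_smul' := fun c ξ => integral_const_mul c _ }
  refine ⟨z.mkContinuous (k * ⨆ t : I, ∫⁻ ω, ‖X ω t‖ₑ ^ k ∂P).toReal fun ξ => ?_, fun ξ =>
    ⟨hint ξ, rfl⟩⟩
  have h := lintegral_functional_tensorPow_le hX P hk ξ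
  have hfin : ‖ξ‖ₑ * (k * ⨆ t : I, ∫⁻ ω, ‖X ω t‖ₑ ^ k ∂P) ≠ ∞ :=
    (ENNReal.mul_lt_top enorm_lt_top (ENNReal.mul_lt_top (ENNReal.natCast_lt_top k) hM)).ne
  refine (norm_integral_le_integral_norm _).trans ?_
  rw [integral_norm_eq_lintegral_enorm (hint ξ).1]
  refine (ENNReal.toReal_mono hfin h).trans_eq ?_
  rw [ENNReal.toReal_mul, toReal_enorm, mul_comm]

section General

variable {B : Type*} [NormedAddCommGroup B] [NormedSpace ℝ B]

/-- The evaluation of an element of the injective tensor power at functionals `ξ₁, …, ξ_k`. -/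
def evalForm (ξ : Fin k → StrongDual ℝ B) : StrongDual ℝ (InjectiveTensorPower B k) :=
  LinearMap.mkContinuous
    { toFun := fun u => u.1 ξ
      map_add' := fun _ _ => rfl
      map_smul' := fun _ _ => rfl }
    (∏ i, ‖ξ i‖) fun u => (BoundedForm.norm_apply_le u.1 ξ).trans_eq (mul_comm _ _)

theorem evalForm_tensorPow (ξ : Fin k → StrongDual ℝ B) (x : B) :
    evalForm ξ (tensorPow k x) = ∏ i, ξ i x :=
  elementaryForm_apply _ _

theorem HasDunfordMoment.weakMomentExists {Y : Ω → B} {P : Measure Ω}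
    {z : StrongDual ℝ (StrongDual ℝ (InjectiveTensorPower B k))} (h : HasDunfordMoment Y P k z) :
    WeakMomentExists Y P k := fun ξ => by
  simpa only [evalForm_tensorPow] using (h (evalForm ξ)).1

theorem add_pow_le_two_pow (a b : ℝ≥0∞) (k : ℕ) : (a + b) ^ k ≤ 2 ^ k * (a ^ k + b ^ k) := by
  rcases le_total a b with h | h
  · calc (a + b) ^ k ≤ (2 * b) ^ k := by rw [two_mul]; gcongr
      _ = 2 ^ k * b ^ k := mul_pow _ _ _
      _ ≤ _ := by gcongr; exact le_add_self
  · calc (a + b) ^ k ≤ (2 * a) ^ k := by rw [two_mul]; gcongr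
      _ = 2 ^ k * a ^ k := mul_pow _ _ _
      _ ≤ _ := by gcongr; exact le_self_add

/-- If the weak moment exists, then the `k`-th absolute moments of `ξ(Y)`, `‖ξ‖ ≤ 1`, are bounded.
This is a uniform boundedness principle: by Fatou's lemma, the sets of functionals with a given
bound for the moment are closed, so by Baire's theorem one of them has an interior point. -/
theorem WeakMomentExists.exists_bound {Y : Ω → B} {P : Measure Ω}
    (h : WeakMomentExists Y P k) :
    ∃ C < ∞, ∀ ξ : StrongDual ℝ B, ‖ξ‖ ≤ 1 → ∫⁻ ω, ‖ξ (Y ω)‖ₑ ^ k ∂P ≤ C := by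
  have hint : ∀ ξ : StrongDual ℝ B, Integrable (fun ω => ξ (Y ω) ^ k) P := fun ξ => by
    simpa using h fun _ => ξ
  have hmeas : ∀ ξ : StrongDual ℝ B, AEMeasurable (fun ω => ‖ξ (Y ω)‖ₑ ^ k) P := fun ξ => by
    simpa only [enorm_pow] using (hint ξ).1.enorm
  have hfin : ∀ ξ : StrongDual ℝ B, ∫⁻ ω, ‖ξ (Y ω)‖ₑ ^ k ∂P < ∞ := fun ξ => by
    simpa only [HasFiniteIntegral, enorm_pow] using (hint ξ).2
  let F : ℕ → Set (StrongDual ℝ B) := fun n => {ξ | ∫⁻ ω, ‖ξ (Y ω)‖ₑ ^ k ∂P ≤ n}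
  have hclosed : ∀ n, IsClosed (F n) := fun n => by
    refine IsSeqClosed.isClosed fun ξ η hξ hη => ?_
    have hlim : ∀ ω, Tendsto (fun m => ‖ξ m (Y ω)‖ₑ ^ k) atTop (𝓝 (‖η (Y ω)‖ₑ ^ k)) := fun ω =>
      ENNReal.Tendsto.pow
        (((ContinuousLinearMap.apply ℝ ℝ (Y ω)).continuous.tendsto η).comp hη).enorm
    calc ∫⁻ ω, ‖η (Y ω)‖ₑ ^ k ∂P = ∫⁻ ω, liminf (fun m => ‖ξ m (Y ω)‖ₑ ^ k) atTop ∂P := by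
          simp_rw [(hlim _).liminf_eq]
      _ ≤ liminf (fun m => ∫⁻ ω, ‖ξ m (Y ω)‖ₑ ^ k ∂P) atTop :=
          lintegral_liminf_le' fun m => hmeas _
      _ ≤ n := by
          refine liminf_le_of_le (by isBoundedDefault) fun b hb => ?_
          obtain ⟨m, hm⟩ := hb.exists
          exact hm.trans (hξ m)
  have hcover : ⋃ n, F n = univ := eq_univ_of_forall fun ξ => by
    obtain ⟨n, hn⟩ := ENNReal.exists_nat_gt (hfin ξ).ne
    exact mem_iUnion.2 ⟨n, hn.le⟩
  obtain ⟨n, ξ₀, hξ₀⟩ := nonempty_interior_of_iUnion_of_closed hclosed hcover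
  obtain ⟨r, hr, hball⟩ := Metric.isOpen_iff.1 isOpen_interior ξ₀ hξ₀
  -- scale `ξ` to `η` with `ξ₀ + η` in the ball, and write `η = (ξ₀ + η) - ξ₀`
  refine ⟨‖2 / r‖ₑ ^ k * (2 ^ k * (n + n)), ENNReal.mul_lt_top (by finiteness) (by finiteness),
    fun ξ hξ => ?_⟩
  set η : StrongDual ℝ B := (r / 2) • ξ with hη
  have hr2 : 0 < r / 2 := half_pos hr
  have h0 : ∫⁻ ω, ‖ξ₀ (Y ω)‖ₑ ^ k ∂P ≤ n := interior_subset (s := F n) hξ₀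
  have h1 : ∫⁻ ω, ‖(ξ₀ + η) (Y ω)‖ₑ ^ k ∂P ≤ n := by
    refine interior_subset (s := F n) (hball ?_)
    rw [Metric.mem_ball, dist_eq_norm, add_sub_cancel_left, hη, norm_smul,
      Real.norm_of_nonneg hr2.le]
    nlinarith
  calc ∫⁻ ω, ‖ξ (Y ω)‖ₑ ^ k ∂P
      ≤ ∫⁻ ω, ‖2 / r‖ₑ ^ k *
          (2 ^ k * (‖(ξ₀ + η) (Y ω)‖ₑ ^ k + ‖ξ₀ (Y ω)‖ₑ ^ k)) ∂P := lintegral_mono fun ω => by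
        have : ξ (Y ω) = 2 / r * ((ξ₀ + η) (Y ω) - ξ₀ (Y ω)) := by
          simp [hη]; field_simp
        rw [this, enorm_mul, mul_pow]
        gcongr
        exact (pow_le_pow_left' enorm_sub_le k).trans (add_pow_le_two_pow _ _ k)
    _ = ‖2 / r‖ₑ ^ k * (2 ^ k * (∫⁻ ω, ‖(ξ₀ + η) (Y ω)‖ₑ ^ k ∂P + ∫⁻ ω, ‖ξ₀ (Y ω)‖ₑ ^ k ∂P)) := by
        rw [lintegral_const_mul' _ _ (by finiteness), lintegral_const_mul' _ _ (by finiteness),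
          lintegral_add_left' (hmeas _)]
    _ ≤ _ := by gcongr

end General

theorem WeakMomentExists.iSup_lt_top {P : Measure Ω} (h : WeakMomentExists X P k) :
    (⨆ t : I, ∫⁻ ω, ‖X ω t‖ₑ ^ k ∂P) < ∞ := by
  obtain ⟨C, hC, h⟩ := h.exists_bound
  refine lt_of_le_of_lt (iSup_le fun t => ?_) hC
  simpa using h (evalAt (ordinary t)) (norm_evalAt_le _)

end

/-! ### The Vitali–Hahn–Saks theorem -/

section VitaliHahnSaks

open scoped symmDiff

variable {Ω : Type*} [MeasurableSpace Ω]

/-- The space of measurable sets with the distance `μ(s ∆ t)` is complete: a sequence of sets with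
summable successive distances converges to its upper limit. -/
theorem completeSpace_measuredSets (μ : Measure Ω) : CompleteSpace (MeasuredSets μ) := by
  refine EMetric.complete_of_convergent_controlled_sequences (fun n => (2⁻¹ : ℝ≥0∞) ^ n)
    (fun n => ENNReal.pow_pos (by simp) n) fun u hu => ?_
  let L : Set Ω := ⋂ n, ⋃ m ≥ n, (u m : Set Ω)
  have hL : MeasurableSet L :=
    MeasurableSet.iInter fun n => MeasurableSet.iUnion fun m =>
      MeasurableSet.iUnion fun _ => (u m).2
  have hsub : ∀ n, (u n : Set Ω) ∆ L ⊆ ⋃ j, (u (n + j) : Set Ω) ∆ u (n + (j + 1)) := by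
    intro n x hx
    by_contra hcon
    have hconst : ∀ j, x ∈ (u (n + j) : Set Ω) ↔ x ∈ (u n : Set Ω) := by
      intro j
      induction j with
      | zero => rfl
      | succ j ih =>
        rw [← ih]
        by_contra h
        exact hcon (mem_iUnion.2 ⟨j, by rw [mem_symmDiff]; tauto⟩)
    have : x ∈ L ↔ x ∈ (u n : Set Ω) := by
      simp only [L, mem_iInter, mem_iUnion]
      constructor
      · intro h
        obtain ⟨m, hm, hx⟩ := h n
        obtain ⟨j, rfl⟩ := Nat.exists_eq_add_of_le hm
        exact (hconst j).1 hx
      · intro h m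
        exact ⟨n + m, Nat.le_add_left _ _, (hconst m).2 h⟩
    rw [mem_symmDiff] at hx
    tauto
  have hdist : ∀ n, μ ((u n : Set Ω) ∆ L) ≤ 2⁻¹ ^ n * 2 := by
    intro n
    calc μ ((u n : Set Ω) ∆ L) ≤ μ (⋃ j, (u (n + j) : Set Ω) ∆ u (n + (j + 1))) :=
          measure_mono (hsub n)
      _ ≤ ∑' j, μ ((u (n + j) : Set Ω) ∆ u (n + (j + 1))) := measure_iUnion_le _
      _ ≤ ∑' j, 2⁻¹ ^ n * 2⁻¹ ^ j := ENNReal.tsum_le_tsum fun j => by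
          rw [← pow_add, ← MeasuredSets.edist_def]
          exact (hu (n + j) _ _ le_rfl (by omega)).le
      _ = 2⁻¹ ^ n * 2 := by
          rw [ENNReal.tsum_mul_left, ENNReal.tsum_geometric, ENNReal.one_sub_inv_two, inv_inv]
  refine ⟨⟨L, hL⟩, tendsto_iff_edist_tendsto_0.2 ?_⟩
  refine tendsto_of_tendsto_of_tendsto_of_le_of_le tendsto_const_nhds ?_ (fun _ => zero_le) hdist
  have h := ENNReal.tendsto_pow_atTop_nhds_zero_of_lt_one (r := 2⁻¹) (by simp)
  simpa using ENNReal.Tendsto.mul_const h (Or.inr (by simp : (2 : ℝ≥0∞) ≠ ∞))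

variable {μ : Measure Ω}

theorem abs_setIntegral_le {Y : Ω → ℝ} {E : Set Ω} {ε : ℝ} (hε : 0 ≤ ε)
    (h : ∫⁻ ω in E, ‖Y ω‖ₑ ∂μ ≤ ENNReal.ofReal ε) : |∫ ω in E, Y ω ∂μ| ≤ ε := by
  have h1 := enorm_integral_le_lintegral_enorm (μ := μ.restrict E) Y
  rw [Real.enorm_eq_ofReal_abs] at h1
  exact (ENNReal.ofReal_le_ofReal_iff hε).1 (h1.trans h)

theorem continuous_setIntegral_measuredSets {Y : Ω → ℝ} (hY : Integrable Y μ) :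
    Continuous fun s : MeasuredSets μ => ∫ ω in (s : Set Ω), Y ω ∂μ := by
  rw [EMetric.continuous_iff]
  intro s ε hε
  rcases eq_or_ne ε ∞ with rfl | hε'
  · exact ⟨1, one_pos, fun _ _ => edist_lt_top _ _⟩
  obtain ⟨δ, hδ, h⟩ := exists_pos_setLIntegral_lt_of_measure_lt hY.2.ne hε.ne'
  refine ⟨δ, hδ, fun t ht => ?_⟩
  have hst : ∀ s t : MeasuredSets μ, ∫ ω in (s : Set Ω), Y ω ∂μ =
      ∫ ω in (s : Set Ω) ∩ t, Y ω ∂μ + ∫ ω in (s : Set Ω) \ t, Y ω ∂μ := fun s t =>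
    (integral_inter_add_sdiff t.2 hY.integrableOn).symm
  have hsymm : μ ((t : Set Ω) ∆ s) < δ := ht
  rw [edist_eq_enorm_sub, hst t s, hst s t, inter_comm (s : Set Ω), add_sub_add_left_eq_sub]
  have hunion := lintegral_union (μ := μ) (f := fun ω => ‖Y ω‖ₑ) (MeasurableSet.diff s.2 t.2)
    (disjoint_sdiff_sdiff (α := Set Ω) (x := t) (y := s))
  calc _ ≤ ‖∫ ω in (t : Set Ω) \ s, Y ω ∂μ‖ₑ + ‖∫ ω in (s : Set Ω) \ t, Y ω ∂μ‖ₑ := enorm_sub_le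
    _ ≤ ∫⁻ ω in (t : Set Ω) \ s, ‖Y ω‖ₑ ∂μ + ∫⁻ ω in (s : Set Ω) \ t, ‖Y ω‖ₑ ∂μ :=
        add_le_add (enorm_integral_le_lintegral_enorm _) (enorm_integral_le_lintegral_enorm _)
    _ = ∫⁻ ω in (t : Set Ω) ∆ s, ‖Y ω‖ₑ ∂μ := hunion.symm
    _ < ε := h _ hsymm

/-- If the integrals over each measurable set of a sequence of integrable functions converge, then
the functions are uniformly absolutely continuous. By Baire's theorem on the space of measurable
sets, the convergence is uniform on a ball; differences of sets from this ball give all sets of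
small measure. -/
theorem vitali_hahn_saks {Y : ℕ → Ω → ℝ} (hYm : ∀ n, Measurable (Y n))
    (hY : ∀ n, Integrable (Y n) μ)
    (hconv : ∀ E, MeasurableSet E → ∃ l, Tendsto (fun n => ∫ ω in E, Y n ω ∂μ) atTop (𝓝 l))
    {ε : ℝ} (hε : 0 < ε) :
    ∃ δ > 0, ∀ E, MeasurableSet E → μ E < δ → ∀ n, ∫⁻ ω in E, ‖Y n ω‖ₑ ∂μ ≤ ENNReal.ofReal ε := by
  have := completeSpace_measuredSets μ
  have : Nonempty (MeasuredSets μ) := ⟨⟨∅, MeasurableSet.empty⟩⟩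
  let φ : ℕ → Set Ω → ℝ := fun n E => ∫ ω in E, Y n ω ∂μ
  have hε6 : 0 < ε / 6 := by positivity
  let F : ℕ → Set (MeasuredSets μ) := fun N => {s | ∀ n, N ≤ n → |φ n s - φ N s| ≤ ε / 6}
  have hclosed : ∀ N, IsClosed (F N) := fun N => by
    have : F N = ⋂ (n : ℕ) (_ : N ≤ n), {s : MeasuredSets μ | |φ n s - φ N s| ≤ ε / 6} := by
      ext s
      simp only [mem_iInter]
      rfl
    rw [this]
    refine isClosed_iInter fun n => isClosed_iInter fun _ => isClosed_le ?_ continuous_const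
    exact ((continuous_setIntegral_measuredSets (hY n)).sub
      (continuous_setIntegral_measuredSets (hY N))).abs
  have hcover : ⋃ N, F N = univ := eq_univ_of_forall fun s => by
    obtain ⟨l, hl⟩ := hconv s s.2
    obtain ⟨N, hN⟩ := Metric.cauchySeq_iff'.1 hl.cauchySeq (ε / 6) hε6
    exact mem_iUnion.2 ⟨N, fun n hn => (Real.dist_eq _ _ ▸ hN n hn).le⟩
  obtain ⟨N, A, hA⟩ := nonempty_interior_of_iUnion_of_closed hclosed hcover
  obtain ⟨r, hr, hball⟩ := EMetric.isOpen_iff.1 isOpen_interior A hA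
  have hball' : ∀ B, MeasurableSet B → μ (B ∆ A) < r → ∀ n, N ≤ n → |φ n B - φ N B| ≤ ε / 6 :=
    fun B hB h => interior_subset (s := F N) (@hball ⟨B, hB⟩ h)
  have hdiff : ∀ E, MeasurableSet E → μ E < r → ∀ n, N ≤ n → |φ n E - φ N E| ≤ ε / 3 := by
    intro E hE hEr n hn
    have h1 := hball' (A ∪ E) (A.2.union hE) ((measure_mono (by
      intro x hx; simp only [mem_symmDiff, mem_union] at hx; tauto)).trans_lt hEr) n hn
    have h2 := hball' (A \ E) (MeasurableSet.diff A.2 hE) ((measure_mono (by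
      intro x hx; simp only [mem_symmDiff, Set.mem_sdiff] at hx; tauto)).trans_lt hEr) n hn
    have h3 : ∀ m, φ m (A ∪ E) = φ m (A \ E) + φ m E := fun m => by
      rw [← sdiff_union_self]
      exact setIntegral_union disjoint_sdiff_left hE (hY m).integrableOn (hY m).integrableOn
    rw [h3, h3] at h1
    rw [abs_le] at *
    constructor <;> linarith [h1.1, h1.2, h2.1, h2.2]
  have hsmall : ∃ δ > 0, ∀ E, μ E < δ → ∀ n ≤ N,
      ∫⁻ ω in E, ‖Y n ω‖ₑ ∂μ ≤ ENNReal.ofReal (ε / 6) := by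
    have hex : ∀ n, ∃ δ > 0, ∀ E, μ E < δ → ∫⁻ ω in E, ‖Y n ω‖ₑ ∂μ < ENNReal.ofReal (ε / 6) :=
      fun n => exists_pos_setLIntegral_lt_of_measure_lt (hY n).2.ne (ENNReal.ofReal_pos.2 hε6).ne'
    choose δ hδ h using hex
    obtain ⟨m, -, hm⟩ := Finset.exists_min_image (Finset.range (N + 1)) δ ⟨0, by simp⟩
    exact ⟨δ m, hδ m, fun E hE n hn =>
      (h n E (hE.trans_le (hm n (Finset.mem_range.2 (Nat.lt_succ_of_le hn))))).le⟩
  obtain ⟨δ, hδ, hsmall⟩ := hsmall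
  refine ⟨min δ r, lt_min hδ hr, fun E hE hEδ n => ?_⟩
  rcases le_or_gt n N with hn | hn
  · exact (hsmall E (hEδ.trans_le (min_le_left _ _)) n hn).trans
      (ENNReal.ofReal_le_ofReal (by linarith))
  have hφ : ∀ B ⊆ E, MeasurableSet B → |φ n B| ≤ ε / 2 := by
    intro B hBE hB
    have hμ := (measure_mono (μ := μ) hBE).trans_lt hEδ
    have h1 := hdiff B hB (hμ.trans_le (min_le_right _ _)) n hn.le
    have h2 : |φ N B| ≤ ε / 6 :=
      abs_setIntegral_le hε6.le (hsmall B (hμ.trans_le (min_le_left _ _)) N le_rfl)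
    rw [abs_le] at *
    constructor <;> linarith [h1.1, h1.2, h2.1, h2.2]
  -- split `E` according to the sign of `Y n`
  have hpos : MeasurableSet {ω | 0 ≤ Y n ω} := measurableSet_le measurable_const (hYm n)
  have h1 := hφ (E ∩ {ω | 0 ≤ Y n ω}) inter_subset_left (hE.inter hpos)
  have h2 := hφ (E \ {ω | 0 ≤ Y n ω}) sdiff_subset (hE.diff hpos)
  have h3 : ∫ ω in E, ‖Y n ω‖ ∂μ = φ n (E ∩ {ω | 0 ≤ Y n ω}) - φ n (E \ {ω | 0 ≤ Y n ω}) := by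
    rw [← integral_inter_add_sdiff hpos (hY n).norm.integrableOn, sub_eq_add_neg, ← integral_neg]
    congr 1
    · exact setIntegral_congr_fun (hE.inter hpos) fun ω hω => Real.norm_of_nonneg hω.2
    · exact setIntegral_congr_fun (hE.diff hpos) fun ω hω =>
        Real.norm_of_nonpos (not_le.1 hω.2).le
  rw [← ofReal_integral_norm_eq_lintegral_enorm (hY n).integrableOn, h3]
  refine ENNReal.ofReal_le_ofReal ?_
  rw [abs_le] at h1 h2
  linarith [h1.2, h2.1]

end VitaliHahnSaks

/-! ### Existence in Pettis sense -/

section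

variable {k : ℕ} {Ω : Type*} [MeasurableSpace Ω] {X : Ω → DSpace}

/-- The paths that are bounded by a constant form a measurable set, because it suffices to consider
countably many times. -/
theorem measurableSet_norm_extend_le (hX : ∀ t : I, Measurable fun ω => X ω t) (C : ℝ) :
    MeasurableSet {ω | ‖extend (X ω)‖ ≤ C} := by
  obtain ⟨Q, hQ, hQd⟩ := TopologicalSpace.exists_countable_dense I
  have hd := dense_image_ordinary (hQd.mono (subset_insert 1 Q)) (mem_insert _ _)
  rcases lt_or_ge C 0 with hC | hC
  · have : {ω | ‖extend (X ω)‖ ≤ C} = ∅ :=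
      eq_empty_of_forall_notMem fun ω hω => absurd (hC.trans_le (norm_nonneg _)) (not_lt.2 hω)
    rw [this]
    exact MeasurableSet.empty
  · have : {ω | ‖extend (X ω)‖ ≤ C} = ⋂ q ∈ insert 1 Q, {ω | ‖X ω q‖ ≤ C} := by
      ext ω
      rw [mem_iInter₂]
      refine (ContinuousMap.norm_le _ hC).trans ⟨fun h q _ => ?_, fun h τ => ?_⟩
      · simpa using h (ordinary q)
      · have hcl : IsClosed {τ | ‖extend (X ω) τ‖ ≤ C} :=
          isClosed_le (map_continuous _).norm continuous_const
        refine closure_minimal ?_ hcl (hd τ)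
        rintro _ ⟨q, hq, rfl⟩
        simpa using! h q hq
    rw [this]
    exact MeasurableSet.biInter (hQ.insert 1) fun q _ =>
      measurableSet_le (hX q).norm measurable_const

theorem prodMap_extend_bound {x : DSpace} {C : ℝ} (h : ‖extend x‖ ≤ C)
    (τ : Fin k → SplitInterval) : ‖prodMap (fun _ => extend x) τ‖ ≤ C ^ k := by
  refine ((prodMap _).norm_coe_le_norm τ).trans ?_
  rw [norm_prodMap_const]
  gcongr

/-- The mean of the tensor power of a bounded random càdlàg function: the expectation of the product
is continuous on `Î^k` by dominated convergence, and represents all functionals. -/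
theorem exists_mean_of_bounded (hX : ∀ t : I, Measurable fun ω => X ω t) (ν : Measure Ω)
    [IsFiniteMeasure ν] {C : ℝ} (hC : ∀ᵐ ω ∂ν, ‖extend (X ω)‖ ≤ C) :
    ∃ G : C(Fin k → SplitInterval, ℝ),
      (∀ τ, G τ = ∫ ω, prodMap (fun _ => extend (X ω)) τ ∂ν) ∧
      ∀ ψ : StrongDual ℝ C(Fin k → SplitInterval, ℝ),
        ψ G = ∫ ω, ψ (prodMap fun _ => extend (X ω)) ∂ν := by
  have hbound : ∀ τ : Fin k → SplitInterval,
      ∀ᵐ ω ∂ν, ‖prodMap (fun _ => extend (X ω)) τ‖ ≤ C ^ k := fun τ => by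
    filter_upwards [hC] with ω hω using prodMap_extend_bound hω τ
  have hint : ∀ τ : Fin k → SplitInterval,
      Integrable (fun ω => prodMap (fun _ => extend (X ω)) τ) ν := fun τ =>
    (integrable_const (C ^ k)).mono' (measurable_prodMap hX τ).aestronglyMeasurable (hbound τ)
  refine ⟨⟨fun τ => ∫ ω, prodMap (fun _ => extend (X ω)) τ ∂ν, ?_⟩, fun _ => rfl, fun ψ => ?_⟩
  · exact continuous_of_dominated (fun τ => (measurable_prodMap hX τ).aestronglyMeasurable) hbound
      (integrable_const _) (Eventually.of_forall fun ω => map_continuous _)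
  · obtain ⟨S, c, hlim, hc⟩ := exists_approx ψ
    refine tendsto_nhds_unique (hlim _) ?_
    have hdom : Tendsto (fun n => ∫ ω, ∑ τ ∈ S n, c n τ * prodMap (fun _ => extend (X ω)) τ ∂ν)
        atTop (𝓝 (∫ ω, ψ (prodMap fun _ => extend (X ω)) ∂ν)) := by
      refine tendsto_integral_of_dominated_convergence (fun _ => ‖ψ‖ * C ^ k) (fun n => ?_)
        (integrable_const _) (fun n => ?_) (Eventually.of_forall fun ω => hlim _)
      · exact (Finset.measurable_sum _ fun τ _ =>
          (measurable_prodMap hX τ).const_mul _).aestronglyMeasurable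
      · filter_upwards [hC] with ω hω
        calc _ ≤ ∑ τ ∈ S n, ‖c n τ * prodMap (fun _ => extend (X ω)) τ‖ := norm_sum_le _ _
          _ ≤ ∑ τ ∈ S n, |c n τ| * C ^ k := Finset.sum_le_sum fun τ _ => by
              rw [norm_mul, Real.norm_eq_abs (c n τ)]
              exact mul_le_mul_of_nonneg_left (prodMap_extend_bound hω τ) (abs_nonneg _)
          _ = (∑ τ ∈ S n, |c n τ|) * C ^ k := (Finset.sum_mul _ _ _).symm
          _ ≤ ‖ψ‖ * C ^ k := by
              have := (norm_nonneg _).trans hω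
              exact mul_le_mul_of_nonneg_right (hc n) (by positivity)
    refine hdom.congr fun n => ?_
    rw [integral_finsetSum _ fun τ _ => (hint τ).const_mul _]
    exact Finset.sum_congr rfl fun τ _ => integral_const_mul _ _

/-- The mean of the tensor power exists in `C(Î^k)` if the contributions of the paths with large
norm to the `k`-th moments of the values are uniformly small: it is then the uniform limit of the means
of the truncations. -/
theorem exists_mean (hX : ∀ t : I, Measurable fun ω => X ω t) (hk : 1 ≤ k) (μ : Measure Ω)
    [IsFiniteMeasure μ] (hM : (⨆ t : I, ∫⁻ ω, ‖X ω t‖ₑ ^ k ∂μ) < ∞)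
    (hsmall : Tendsto (fun m : ℕ => ⨆ t : I, ∫⁻ ω in {ω | ‖extend (X ω)‖ ≤ m}ᶜ, ‖X ω t‖ₑ ^ k ∂μ)
      atTop (𝓝 0)) :
    ∃ G : C(Fin k → SplitInterval, ℝ), ∀ ψ : StrongDual ℝ C(Fin k → SplitInterval, ℝ),
      ψ G = ∫ ω, ψ (prodMap fun _ => extend (X ω)) ∂μ := by
  let A : ℕ → Set Ω := fun m => {ω | ‖extend (X ω)‖ ≤ m}
  have hA : ∀ m, MeasurableSet (A m) := fun m => measurableSet_norm_extend_le hX m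
  have hmono : Monotone A := fun m n hmn ω hω =>
    (show ‖extend (X ω)‖ ≤ m from hω).trans (Nat.cast_le.2 hmn)
  have hunion : ⋃ m, A m = univ := eq_univ_of_forall fun ω =>
    mem_iUnion.2 (exists_nat_ge ‖extend (X ω)‖)
  choose G hG hGψ using fun m => exists_mean_of_bounded (k := k) hX (μ.restrict (A m))
    (ae_restrict_mem (hA m))
  have hfin : k * (⨆ t : I, ∫⁻ ω, ‖X ω t‖ₑ ^ k ∂μ) < ∞ :=
    ENNReal.mul_lt_top (ENNReal.natCast_lt_top k) hM
  have hint : ∀ τ : Fin k → SplitInterval,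
      Integrable (fun ω => prodMap (fun _ => extend (X ω)) τ) μ := fun τ =>
    ⟨(measurable_prodMap hX τ).aestronglyMeasurable,
      (lintegral_prod_extend_le hX μ hk τ).trans_lt hfin⟩
  let F : (Fin k → SplitInterval) → ℝ := fun τ => ∫ ω, prodMap (fun _ => extend (X ω)) τ ∂μ
  have hunif : TendstoUniformly (fun m τ => G m τ) F atTop := by
    have hsmall' : Tendsto (fun m : ℕ => k * ⨆ t : I, ∫⁻ ω in (A m)ᶜ, ‖X ω t‖ₑ ^ k ∂μ) atTop
        (𝓝 0) := by
      simpa only [mul_zero] using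
        ENNReal.Tendsto.const_mul hsmall (Or.inr (ENNReal.natCast_ne_top k))
    rw [EMetric.tendstoUniformly_iff]
    intro ε hε
    filter_upwards [hsmall'.eventually (gt_mem_nhds hε)] with m hm τ
    have : F τ - G m τ = ∫ ω in (A m)ᶜ, prodMap (fun _ => extend (X ω)) τ ∂μ := by
      rw [hG, sub_eq_iff_eq_add']
      exact (integral_add_compl (hA m) (hint τ)).symm
    rw [edist_eq_enorm_sub, this]
    exact ((enorm_integral_le_lintegral_enorm _).trans
      (lintegral_prod_extend_le hX _ hk τ)).trans_lt hm
  have hF : Continuous F :=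
    hunif.continuous (Frequently.of_forall fun m => map_continuous (G m))
  refine ⟨⟨F, hF⟩, fun ψ => ?_⟩
  have h1 : Tendsto (fun m => ψ (G m)) atTop (𝓝 (ψ ⟨F, hF⟩)) :=
    (ψ.continuous.tendsto _).comp (ContinuousMap.tendsto_iff_tendstoUniformly.2 hunif)
  refine tendsto_nhds_unique h1 ?_
  have hintψ : Integrable (fun ω => ψ (prodMap fun _ => extend (X ω))) μ :=
    ⟨(measurable_functional hX ψ).aestronglyMeasurable,
      (lintegral_functional_le hX μ hk ψ).trans_lt (ENNReal.mul_lt_top enorm_lt_top hfin)⟩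
  have h2 := tendsto_setIntegral_of_monotone hA hmono (μ := μ) hintψ.integrableOn
  rw [hunion, setIntegral_univ] at h2
  exact h2.congr fun m => (hGψ m ψ).symm

theorem eLpNorm_abs_pow (t : I) (k : ℕ) (μ : Measure Ω) :
    eLpNorm (fun ω => |X ω t| ^ k) 1 μ = ∫⁻ ω, ‖X ω t‖ₑ ^ k ∂μ := by
  rw [eLpNorm_one_eq_lintegral_enorm]
  simp [enorm_pow]

theorem iSup_lt_top_of_uniformIntegrable {P : Measure Ω}
    (h : UniformIntegrable (fun (t : I) ω => |X ω t| ^ k) 1 P) :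
    (⨆ t : I, ∫⁻ ω, ‖X ω t‖ₑ ^ k ∂P) < ∞ := by
  obtain ⟨C, hC⟩ := h.2.2
  refine (iSup_le fun t => ?_).trans_lt (ENNReal.coe_lt_top (r := C))
  rw [← eLpNorm_abs_pow]
  exact hC t

theorem iSup_lintegral_mono {μ ν : Measure Ω} (h : μ ≤ ν) :
    (⨆ t : I, ∫⁻ ω, ‖X ω t‖ₑ ^ k ∂μ) ≤ ⨆ t : I, ∫⁻ ω, ‖X ω t‖ₑ ^ k ∂ν :=
  iSup_mono fun _ => lintegral_mono' h le_rfl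

theorem tendsto_iSup_truncation (hX : ∀ t : I, Measurable fun ω => X ω t) {P : Measure Ω}
    [IsFiniteMeasure P] (h : UniformIntegrable (fun (t : I) ω => |X ω t| ^ k) 1 P) :
    Tendsto (fun m : ℕ => ⨆ t : I, ∫⁻ ω in {ω | ‖extend (X ω)‖ ≤ m}ᶜ, ‖X ω t‖ₑ ^ k ∂P)
      atTop (𝓝 0) := by
  let A : ℕ → Set Ω := fun m => {ω | ‖extend (X ω)‖ ≤ m}
  have hA : ∀ m, MeasurableSet (A m) := fun m => measurableSet_norm_extend_le hX m
  have hP : Tendsto (fun m => P (A m)ᶜ) atTop (𝓝 0) := by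
    have hanti : Antitone fun m => (A m)ᶜ := fun m n hmn =>
      compl_subset_compl.2 fun ω (hω : ‖extend (X ω)‖ ≤ m) => hω.trans (Nat.cast_le.2 hmn)
    have hinter : ⋂ m, (A m)ᶜ = ∅ := by
      rw [← compl_iUnion, compl_empty_iff]
      exact eq_univ_of_forall fun ω => mem_iUnion.2 (exists_nat_ge ‖extend (X ω)‖)
    have := tendsto_measure_iInter_atTop (μ := P) (fun m => (hA m).compl.nullMeasurableSet) hanti
      ⟨0, measure_ne_top _ _⟩
    rwa [hinter, measure_empty] at this
  refine ENNReal.tendsto_nhds_zero.2 fun ε hε => ?_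
  obtain ⟨ε', hε'0, hε'⟩ : ∃ ε' : ℝ, 0 < ε' ∧ ENNReal.ofReal ε' ≤ ε := by
    rcases eq_or_ne ε ∞ with rfl | htop
    · exact ⟨1, one_pos, le_top⟩
    · exact ⟨ε.toReal, ENNReal.toReal_pos hε.ne' htop, ENNReal.ofReal_toReal_le⟩
  obtain ⟨δ, hδ, hUI⟩ := h.2.1 hε'0
  filter_upwards [hP.eventually (ge_mem_nhds (ENNReal.ofReal_pos.2 hδ))] with m hm
  refine iSup_le fun t => ?_
  have := hUI t _ (hA m).compl hm
  rw [eLpNorm_indicator_eq_eLpNorm_restrict (hA m).compl, eLpNorm_abs_pow] at this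
  exact this.trans hε'

theorem exists_hasPettisMoment (hX : ∀ t : I, Measurable fun ω => X ω t) (hk : 1 ≤ k)
    {P : Measure Ω} [IsFiniteMeasure P]
    (h : UniformIntegrable (fun (t : I) ω => |X ω t| ^ k) 1 P) :
    ∃ z, HasPettisMoment X P k z := by
  have hM := iSup_lt_top_of_uniformIntegrable h
  have key : ∀ E, MeasurableSet E → ∃ y : InjectiveTensorPower DSpace k,
      HasDunfordIntegral (E.indicator fun ω => tensorPow k (X ω)) P
        (NormedSpace.inclusionInDoubleDual ℝ _ y) := by
    intro E hE
    have hle : ∀ F : Set Ω, (P.restrict E).restrict F ≤ P.restrict F := fun F =>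
      Measure.restrict_mono le_rfl Measure.restrict_le_self
    obtain ⟨G, hG⟩ := exists_mean hX hk (P.restrict E)
      ((iSup_lintegral_mono Measure.restrict_le_self).trans_lt hM)
      (tendsto_of_tendsto_of_tendsto_of_le_of_le tendsto_const_nhds (tendsto_iSup_truncation hX h)
        (fun _ => zero_le) fun _ => iSup_lintegral_mono (hle _))
    refine ⟨(tensorEquiv k).symm G, fun ξ => ?_⟩
    have hind : (fun ω => ξ (E.indicator (fun ω => tensorPow k (X ω)) ω)) =
        E.indicator fun ω => ξ (tensorPow k (X ω)) := by
      ext ω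
      by_cases hω : ω ∈ E <;> simp [hω]
    rw [hind]
    refine ⟨(integrable_functional_tensorPow hX hk hM ξ).indicator hE, ?_⟩
    rw [integral_indicator hE, NormedSpace.dual_def]
    have h := hG (transfer ξ)
    simp only [transfer_prodMap] at h
    exact h
  obtain ⟨z, hz⟩ := key univ MeasurableSet.univ
  rw [indicator_univ] at hz
  exact ⟨z, hz, key⟩

/-- The evaluation of an element of the injective tensor power at a point of `Î^k`. -/
def pointEval (τ : Fin k → SplitInterval) : StrongDual ℝ (InjectiveTensorPower DSpace k) :=
  evalForm fun i => evalAt (τ i)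

theorem pointEval_apply (τ : Fin k → SplitInterval) (u : InjectiveTensorPower DSpace k) :
    pointEval τ u = tensorEquiv k u τ := rfl

theorem pointEval_tensorPow (τ : Fin k → SplitInterval) (x : DSpace) :
    pointEval τ (tensorPow k x) = ∏ i, extend x (τ i) :=
  evalForm_tensorPow _ _

/-- If the Pettis moment exists, then `E(1_E X(t)^k)` depends continuously on the point `t` of the
sequentially compact split interval, for every event `E`. Hence a sequence that violates uniform
integrability would contradict the Vitali–Hahn–Saks theorem. -/
theorem HasPettisMoment.uniformIntegrable (hX : ∀ t : I, Measurable fun ω => X ω t)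
    {P : Measure Ω} [IsFiniteMeasure P] {z : InjectiveTensorPower DSpace k}
    (h : HasPettisMoment X P k z) :
    UniformIntegrable (fun (t : I) ω => |X ω t| ^ k) 1 P := by
  have hM := (HasDunfordMoment.weakMomentExists h.1).iSup_lt_top
  have hint : ∀ t, Integrable (fun ω => X ω t ^ k) P := fun t => by
    simpa [pointEval_tensorPow] using (h.1 (pointEval fun _ => ordinary t)).1
  refine ⟨fun t => ((hX t).abs.pow_const k).aestronglyMeasurable, fun ε hε => ?_,
    (⨆ t : I, ∫⁻ ω, ‖X ω t‖ₑ ^ k ∂P).toNNReal, fun t => ?_⟩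
  · by_contra! hcon
    choose t E hE hPE hlt using fun n : ℕ => hcon (1 / (n + 1)) Nat.one_div_pos_of_nat
    obtain ⟨τ, φ, hφ, hτ⟩ := SeqCompactSpace.tendsto_subseq fun n => ordinary (t n)
    have hconv : ∀ F, MeasurableSet F →
        ∃ l, Tendsto (fun n => ∫ ω in F, X ω (t (φ n)) ^ k ∂P) atTop (𝓝 l) := by
      intro F hF
      obtain ⟨y, hy⟩ := h.2 F hF
      have hval : ∀ r : I, tensorEquiv k y (fun _ => ordinary r) = ∫ ω in F, X ω r ^ k ∂P := by
        intro r
        have h1 := (hy (pointEval fun _ => ordinary r)).2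
        rw [NormedSpace.dual_def, pointEval_apply] at h1
        rw [h1, ← integral_indicator hF]
        refine integral_congr_ae (Eventually.of_forall fun ω => ?_)
        by_cases hω : ω ∈ F
        · simp [hω, pointEval_tensorPow]
        · simp [hω]
      refine ⟨tensorEquiv k y fun _ => τ, ?_⟩
      simp only [← hval]
      exact ((map_continuous (tensorEquiv k y)).tendsto _).comp (tendsto_pi_nhds.2 fun _ => hτ)
    obtain ⟨δ, hδ, hVHS⟩ := vitali_hahn_saks (fun n => (hX (t (φ n))).pow_const k)
      (fun n => hint _) hconv hε
    have hlim : Tendsto (fun n => ENNReal.ofReal (1 / ((φ n : ℝ) + 1))) atTop (𝓝 0) := by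
      have := (ENNReal.tendsto_ofReal tendsto_one_div_add_atTop_nhds_zero_nat).comp
        hφ.tendsto_atTop
      simpa [Function.comp_def] using this
    obtain ⟨n, hn⟩ := (hlim.eventually (gt_mem_nhds hδ)).exists
    have h1 := hVHS (E (φ n)) (hE _) ((hPE _).trans_lt hn) n
    have h2 := hlt (φ n)
    rw [eLpNorm_indicator_eq_eLpNorm_restrict (hE _), eLpNorm_abs_pow] at h2
    simp only [enorm_pow] at h1
    exact absurd h2 (not_lt.2 h1)
  · rw [eLpNorm_abs_pow, ENNReal.coe_toNNReal hM.ne]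
    exact le_iSup (fun t => ∫⁻ ω, ‖X ω t‖ₑ ^ k ∂P) t

end

/-! ### Existence in Bochner sense -/

section

variable {k : ℕ} {Ω : Type*} [MeasurableSpace Ω] {X : Ω → DSpace}

theorem enorm_extend (x : DSpace) : ‖extend x‖ₑ = ⨆ t : I, ‖x t‖ₑ := by
  have hle : ⨆ t : I, ‖x t‖ₑ ≤ ‖extend x‖ₑ := iSup_le fun t => by
    rw [← extend_ordinary, ← ofReal_norm, ← ofReal_norm]
    exact ENNReal.ofReal_le_ofReal ((extend x).norm_coe_le_norm _)
  refine le_antisymm ?_ hle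
  have hfin : ⨆ t : I, ‖x t‖ₑ ≠ ∞ := (hle.trans_lt enorm_lt_top).ne
  rw [← ofReal_norm, ← ENNReal.ofReal_toReal hfin]
  refine ENNReal.ofReal_le_ofReal ((ContinuousMap.norm_le _ ENNReal.toReal_nonneg).2 fun τ => ?_)
  refine denseRange_ordinary.induction_on (p := fun τ => ‖extend x τ‖ ≤ _) τ
    (isClosed_le (map_continuous _).norm continuous_const) fun t => ?_
  rw [extend_ordinary, ← toReal_enorm]
  exact ENNReal.toReal_mono hfin (le_iSup (fun t => ‖x t‖ₑ) t)

theorem enorm_tensorPow (x : DSpace) : ‖tensorPow k x‖ₑ = (⨆ t : I, ‖x t‖ₑ) ^ k := by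
  rw [← enorm_extend, ← ofReal_norm, ← ofReal_norm, ← ENNReal.ofReal_pow (norm_nonneg _),
    ← norm_prodMap_const, ← tensorEquiv_tensorPow, (tensorEquiv k).norm_map]

theorem continuous_prodMap_const :
    Continuous fun f : C(SplitInterval, ℝ) => prodMap fun _ : Fin k => f := by
  have : (fun f : C(SplitInterval, ℝ) => prodMap fun _ : Fin k => f) =
      fun f => ∏ i : Fin k, f.comp ⟨fun τ : Fin k → SplitInterval => τ i, continuous_apply i⟩ := by
    ext f τ
    simp
  rw [this]
  exact continuous_finsetProd _ fun i _ => ContinuousMap.continuous_precomp _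

theorem jump_zero (f : I → ℝ) : jump f 0 = 0 := by
  rw [jump, leftLim_eq_of_isBot fun t => unitInterval.nonneg', sub_self]

theorem jump_eq (x : DSpace) (t : I) (ht : 0 < t) :
    jump x t = extend x (ordinary t) - extend x (minus t ht) := by
  rw [extend_ordinary, extend_minus, jump]

/-- If the jumps occur at the points of a countable set, then the random function is a limit, in the
supremum norm, of random step functions with fixed jump points. -/
theorem aestronglyMeasurable_extend (hX : ∀ t : I, Measurable fun ω => X ω t) {P : Measure Ω}
    {N : Set I} (hN : N.Countable) (h : ∀ᵐ ω ∂P, Function.support (jump (X ω)) ⊆ N) :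
    AEStronglyMeasurable (fun ω => extend (X ω)) P := by
  obtain ⟨s, hs, hsN⟩ := exists_isGrid hN
  refine aestronglyMeasurable_of_tendsto_ae atTop
    (f := fun n ω => (extend (X ω)).comp (hs.round n)) (fun n => ?_) ?_
  · obtain ⟨e, he, -⟩ := exists_comp_eq_sum (hs.round n) (finite_range_gridRound s n)
    simp only [he]
    refine (Finset.stronglyMeasurable_fun_sum _ fun τ _ => ?_).aestronglyMeasurable
    exact (measurable_extend hX τ).stronglyMeasurable.smul_const _
  · filter_upwards [h] with ω hω
    refine hs.tendsto_comp_round _ fun t ht hne => hsN t (hω ?_) ht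
    rw [Function.mem_support, jump_eq _ _ ht, sub_ne_zero]
    exact hne.symm

theorem exists_hasBochnerMoment (hX : ∀ t : I, Measurable fun ω => X ω t) {P : Measure Ω}
    (hfin : ∫⁻ ω, (⨆ t : I, ‖X ω t‖ₑ) ^ k ∂P < ∞)
    {N : Set I} (hN : N.Countable) (h : ∀ᵐ ω ∂P, Function.support (jump (X ω)) ⊆ N) :
    ∃ z, HasBochnerMoment X P k z := by
  refine ⟨_, ⟨?_, ?_⟩, rfl⟩
  · have h1 := ((tensorEquiv k).symm.continuous.comp
      continuous_prodMap_const).comp_aestronglyMeasurable (aestronglyMeasurable_extend hX hN h)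
    refine h1.congr (Eventually.of_forall fun ω => ?_)
    simp [← tensorEquiv_tensorPow]
  · simpa only [HasFiniteIntegral, enorm_tensorPow] using hfin

/-- The function `G` on `Î^k` does not distinguish `a-` and `a` in any coordinate, for `a ∉ N`. -/
def JumpsIn (G : C(Fin k → SplitInterval, ℝ)) (N : Set I) : Prop :=
  ∀ a ∉ N, ∀ (ha : 0 < a) (i : Fin k) (τ : Fin k → SplitInterval),
    G (Function.update τ i (minus a ha)) = G (Function.update τ i (ordinary a))

theorem JumpsIn.mono {G : C(Fin k → SplitInterval, ℝ)} {N M : Set I} (h : JumpsIn G N)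
    (hNM : N ⊆ M) : JumpsIn G M :=
  fun a ha => h a fun h' => ha (hNM h')

theorem isClosed_setOf_jumpsIn (N : Set I) :
    IsClosed {G : C(Fin k → SplitInterval, ℝ) | JumpsIn G N} := by
  have : {G : C(Fin k → SplitInterval, ℝ) | JumpsIn G N} =
      ⋂ (a : I) (_ : a ∉ N) (ha : 0 < a) (i : Fin k) (τ : Fin k → SplitInterval),
        {G : C(Fin k → SplitInterval, ℝ) |
          G (Function.update τ i (minus a ha)) = G (Function.update τ i (ordinary a))} := by
    ext G
    simp only [mem_iInter]
    rfl
  rw [this]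
  exact isClosed_iInter fun a => isClosed_iInter fun _ => isClosed_iInter fun ha =>
    isClosed_iInter fun i => isClosed_iInter fun τ =>
      isClosed_eq (continuous_eval_const _) (continuous_eval_const _)

/-- A continuous function on `Î^k` has jumps at countably many places only, because the functions
with this property form a closed subalgebra. -/
theorem exists_countable_jumpsIn (G : C(Fin k → SplitInterval, ℝ)) :
    ∃ N : Set I, N.Countable ∧ JumpsIn G N := by
  let 𝒜 : Subalgebra ℝ C(Fin k → SplitInterval, ℝ) :=
    { carrier := {G | ∃ N : Set I, N.Countable ∧ JumpsIn G N}
      algebraMap_mem' := fun c => ⟨∅, countable_empty, fun a _ ha i τ => rfl⟩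
      add_mem' := by
        rintro G H ⟨N, hN, hG⟩ ⟨M, hM, hH⟩
        refine ⟨N ∪ M, hN.union hM, fun a ha ha0 i τ => ?_⟩
        rw [ContinuousMap.add_apply, ContinuousMap.add_apply,
          hG.mono subset_union_left a ha, hH.mono subset_union_right a ha]
      mul_mem' := by
        rintro G H ⟨N, hN, hG⟩ ⟨M, hM, hH⟩
        refine ⟨N ∪ M, hN.union hM, fun a ha ha0 i τ => ?_⟩
        rw [ContinuousMap.mul_apply, ContinuousMap.mul_apply,
          hG.mono subset_union_left a ha, hH.mono subset_union_right a ha] }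
  have hclosed : IsClosed (𝒜 : Set C(Fin k → SplitInterval, ℝ)) := by
    refine isClosed_of_closure_subset fun G hG => ?_
    obtain ⟨H, hH, hHG⟩ := mem_closure_iff_seq_limit.1 hG
    choose N hN hHN using hH
    refine ⟨⋃ n, N n, countable_iUnion hN, ?_⟩
    exact (isClosed_setOf_jumpsIn _).mem_of_tendsto hHG
      (Eventually.of_forall fun n => (hHN n).mono (subset_iUnion N n))
  have htop : 𝒜 = ⊤ := by
    refine subalgebra_eq_top 𝒜 hclosed fun j b =>
      ⟨{b}, countable_singleton b, fun a ha ha0 i τ => ?_⟩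
    rw [stepAt_apply, stepAt_apply]
    rcases eq_or_ne j i with rfl | hji
    · rw [Function.update_self, Function.update_self]
      rcases lt_or_gt_of_ne (show a ≠ b from ha) with h | h
      · have h' : ordinary a < ordinary b := lt_of_val_lt h
        rw [step_of_lt ((minus_lt_ordinary a ha0).trans h'), step_of_lt h']
      · rw [step_of_le (lt_minus_iff.2 h).le, step_of_le (le_ordinary_iff.2 h.le)]
    · rw [Function.update_of_ne hji, Function.update_of_ne hji]
  exact (show G ∈ 𝒜 from htop ▸ Algebra.mem_top)

/-- The jumps of a function can be recovered from its tensor power: fix all coordinates but one at a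
point where the function does not vanish. -/
theorem support_jump_subset (hk : 1 ≤ k) {x : DSpace} {N : Set I}
    (h : JumpsIn (prodMap fun _ : Fin k => extend x) N) : Function.support (jump x) ⊆ N := by
  intro a ha
  by_contra haN
  have ha0 : 0 < a := by
    refine lt_of_le_of_ne unitInterval.nonneg' ?_
    rintro rfl
    exact ha (jump_zero _)
  rw [Function.mem_support, jump_eq _ _ ha0, sub_ne_zero] at ha
  obtain ⟨τ, hτ⟩ : ∃ τ, extend x τ ≠ 0 := by
    by_contra! h0
    exact ha (by rw [h0, h0])
  have h1 := h a haN ha0 ⟨0, hk⟩ fun _ => τ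
  simp only [prodMap_apply, Function.apply_update (fun _ : Fin k => extend x)] at h1
  rw [Finset.prod_update_of_mem (Finset.mem_univ _), Finset.prod_update_of_mem (Finset.mem_univ _),
    Finset.prod_const] at h1
  exact ha (mul_right_cancel₀ (pow_ne_zero _ hτ) h1).symm

/-- A Bochner integrable function has a separable range up to null sets, and a separable set of
functions on `Î^k` has jumps at countably many places only. -/
theorem HasBochnerMoment.exists_countable {P : Measure Ω} (hk : 1 ≤ k)
    {z : InjectiveTensorPower DSpace k} (h : HasBochnerMoment X P k z) :
    ∃ N : Set I, N.Countable ∧ ∀ᵐ ω ∂P, Function.support (jump (X ω)) ⊆ N := by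
  have hmeas := (tensorEquiv k).continuous.comp_aestronglyMeasurable h.1.1
  obtain ⟨T, ⟨c, hc, hTc⟩, hT⟩ := hmeas.isSeparable_ae_range
  choose N hN hGN using fun G : C(Fin k → SplitInterval, ℝ) => exists_countable_jumpsIn G
  refine ⟨⋃ G ∈ c, N G, hc.biUnion fun G _ => hN G, ?_⟩
  filter_upwards [hT] with ω hω
  refine support_jump_subset hk ?_
  rw [← tensorEquiv_tensorPow]
  exact closure_minimal (fun G hG => (hGN G).mono (subset_biUnion_of_mem hG))
    (isClosed_setOf_jumpsIn _) (hTc hω)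

theorem HasBochnerMoment.lintegral_lt_top {P : Measure Ω}
    {z : InjectiveTensorPower DSpace k} (h : HasBochnerMoment X P k z) :
    ∫⁻ ω, (⨆ t : I, ‖X ω t‖ₑ) ^ k ∂P < ∞ := by
  simpa only [HasFiniteIntegral, enorm_tensorPow] using h.1.2

/-! ### The moment as a function in `D([0,1]^k)` -/

/-- The natural isometric isomorphism of the injective tensor power of `D[0,1]` with
`D([0,1]^k)`. -/
def tensorCadlagEquiv (k : ℕ) : InjectiveTensorPower DSpace k ≃ₗᵢ[ℝ] DPowSpace k :=
  (tensorEquiv k).trans (cadlagPowEquiv k)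

theorem tensorCadlagEquiv_apply (u : InjectiveTensorPower DSpace k) (t : Fin k → I) :
    tensorCadlagEquiv k u t = pointEval (fun i => ordinary (t i)) u := rfl

theorem tensorCadlagEquiv_elementaryTensor (x : Fin k → DSpace) (t : Fin k → I) :
    tensorCadlagEquiv k (elementaryTensor x) t = ∏ i, x i (t i) := by
  rw [tensorCadlagEquiv_apply, pointEval_apply, tensorEquiv_elementaryTensor]
  simp

theorem hasDunfordMoment_of_bochner_or_pettis {P : Measure Ω}
    {z : InjectiveTensorPower DSpace k} (h : HasBochnerMoment X P k z ∨ HasPettisMoment X P k z) :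
    HasDunfordMoment X P k (NormedSpace.inclusionInDoubleDual ℝ _ z) := by
  rcases h with ⟨h, rfl⟩ | h
  · exact fun ξ => ⟨ξ.integrable_comp h, (ξ.integral_comp_comm h).symm⟩
  · exact h.1

end

end

end CadlagMoment

theorem theorem14p2 {Ω : Type*} [MeasurableSpace Ω] (P : Measure Ω) [IsProbabilityMeasure P]
    (X : Ω → CadlagMoment.DSpace) (hX : ∀ t : I, Measurable fun ω => X ω t)
    (k : ℕ) (hk : 1 ≤ k) :
    -- Dunford sense
    (((∃ z, CadlagMoment.HasDunfordMoment X P k z) ↔ CadlagMoment.WeakMomentExists X P k) ∧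
      (CadlagMoment.WeakMomentExists X P k ↔ (⨆ t : I, ∫⁻ ω, ‖X ω t‖ₑ ^ k ∂P) < ∞)) ∧
    -- Pettis sense
    ((∃ z, CadlagMoment.HasPettisMoment X P k z) ↔
      UniformIntegrable (fun (t : I) ω => |X ω t| ^ k) 1 P) ∧
    -- Bochner sense
    ((∃ z, CadlagMoment.HasBochnerMoment X P k z) ↔
      (∫⁻ ω, (⨆ t : I, ‖X ω t‖ₑ) ^ k ∂P) < ∞ ∧
        ∃ N : Set I, N.Countable ∧
          ∀ᵐ ω ∂P, Function.support (CadlagMoment.jump (X ω)) ⊆ N) ∧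
    -- the natural isometric identification of the injective tensor power with `D([0,1]^k)`
    ∃ Φ : CadlagMoment.InjectiveTensorPower CadlagMoment.DSpace k ≃ₗᵢ[ℝ] CadlagMoment.DPowSpace k,
      (∀ (x : Fin k → CadlagMoment.DSpace) (t : Fin k → I),
        Φ (CadlagMoment.elementaryTensor x) t = ∏ i, x i (t i)) ∧
      -- under it, the moment is the function `t ↦ E(X(t₁) ⋯ X(t_k))`
      ∀ z, CadlagMoment.HasBochnerMoment X P k z ∨ CadlagMoment.HasPettisMoment X P k z →
        ∀ t : Fin k → I, Integrable (fun ω => ∏ i, X ω (t i)) P ∧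
          Φ z t = ∫ ω, ∏ i, X ω (t i) ∂P := by
  refine ⟨⟨⟨fun ⟨z, hz⟩ => CadlagMoment.HasDunfordMoment.weakMomentExists hz,
      fun h => CadlagMoment.exists_hasDunfordMoment hX hk h.iSup_lt_top⟩,
      fun h => h.iSup_lt_top, fun h => ?_⟩,
    ⟨fun ⟨z, hz⟩ => CadlagMoment.HasPettisMoment.uniformIntegrable hX hz,
      fun h => CadlagMoment.exists_hasPettisMoment hX hk h⟩,
    ⟨fun ⟨z, hz⟩ =>
        ⟨CadlagMoment.HasBochnerMoment.lintegral_lt_top hz,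
          CadlagMoment.HasBochnerMoment.exists_countable hk hz⟩,
      fun ⟨hfin, N, hN, h⟩ =>
        CadlagMoment.exists_hasBochnerMoment hX hfin hN h⟩,
    CadlagMoment.tensorCadlagEquiv k,
    CadlagMoment.tensorCadlagEquiv_elementaryTensor, fun z hz t => ?_⟩
  · obtain ⟨z, hz⟩ := CadlagMoment.exists_hasDunfordMoment hX hk h
    exact CadlagMoment.HasDunfordMoment.weakMomentExists hz
  · have h := CadlagMoment.hasDunfordMoment_of_bochner_or_pettis hz
      (CadlagMoment.pointEval fun i => CadlagMoment.SplitInterval.ordinary (t i))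
    simp only [CadlagMoment.pointEval_tensorPow, CadlagMoment.extend_ordinary] at h
    exact h
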